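/- Let $\mathcal{D}$ be a triangulated category with translation functor $\Sigma$ and a bounded $t$-structure $(\mathcal{D}^{\leq 0},\mathcal{D}^{\geq 0})$, that is, every object of $\mathcal{D}$ lies in $\Sigma^i\mathcal{D}^{\leq 0}\cap\Sigma^j\mathcal{D}^{\geq 0}$ for some $i,j\in\mathbb{Z}$. Let $\mathcal{A}=\mathcal{D}^{\leq 0}\cap\mathcal{D}^{\geq 0}$ be its heart, which is an abelian category. For $X,Y\in\mathcal{A}$ and $n\geq 1$ let $\mathrm{Yext}^n_{\mathcal{A}}(X,Y)$ be the Yoneda extension group: the classes $[\xi]$ of exact sequences $\xi\colon 0\to Y\to E^{-n+1}\to\cdots\to E^0\to X\to 0$ in $\mathcal{A}$, modulo the equivalence relation generated by morphisms of exact sequences that are the identity on $X$ and on $Y$, with the Baer sum as addition. The canonical map $$\theta^n=\theta^n_{X,Y}\colon \mathrm{Yext}^n_{\mathcal{A}}(X,Y)\longrightarrow \mathrm{Hom}_{\mathcal{D}}(X,\Sigma^nY)$$ is defined as follows. For a short exact sequence $\xi\colon 0\to Y\xrightarrow{f}E\xrightarrow{g}X\to 0$ in $\mathcal{A}$, $\theta^1(\xi)$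 is the unique morphism for which $Y\xrightarrow{f}E\xrightarrow{g}X\xrightarrow{\theta^1(\xi)}\Sigma Y$ is an exact triangle. If $\xi$ is the splice of $\xi_1\in\mathrm{Yext}^1_{\mathcal{A}}(Z,Y)$ and $\xi_2\in\mathrm{Yext}^n_{\mathcal{A}}(X,Z)$, then $\theta^{n+1}(\xi)=\Sigma^n(\theta^1(\xi_1))\circ\theta^n(\xi_2)$. Let $\mathbf{D}^b(\mathcal{A})$ be the bounded derived category of $\mathcal{A}$, where $\mathcal{A}$ is identified with the heart of the canonical $t$-structure (stalk complexes in degree $0$), put $\mathrm{Ext}^n_{\mathcal{A}}(X,Y)=\mathrm{Hom}_{\mathbf{D}^b(\mathcal{A})}(X,\Sigma^nY)$, and let $\chi^n\colon\mathrm{Yext}^n_{\mathcal{A}}(X,Y)\to\mathrm{Ext}^n_{\mathcal{A}}(X,Y)$ be the canonical map of this $t$-structure. Let $(F,\omega)\colon\mathbf{D}^b(\mathcal{A})\to\mathcal{D}$ be a realization functor, i.e. a triangle functor together with a natural isomorphism between its restriction to $\mathcal{A}$ and the inclusion $\mathcal{A}\hookrightarrow\mathcal{D}$. For $X,Y\in\mathcal{A}$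 it induces homomorphisms $$F^n\colon\mathrm{Ext}^n_{\mathcal{A}}(X,Y)\longrightarrow\mathrm{Hom}_{\mathcal{D}}(X,\Sigma^nY),\qquad f\mapsto \omega^n_Y\circ F(f),$$ where $F(X)$ and $F(Y)$ are identified with $X$ and $Y$. Then $F^n\circ\chi^n=\theta^n$ for all $X,Y\in\mathcal{A}$ and all $n\geq 1$. Moreover, for all $X,Y\in\mathcal{A}$, the map $F^1\colon\mathrm{Ext}^1_{\mathcal{A}}(X,Y)\to\mathrm{Hom}_{\mathcal{D}}(X,\Sigma Y)$ is an isomorphism and the map $F^2\colon\mathrm{Ext}^2_{\mathcal{A}}(X,Y)\to\mathrm{Hom}_{\mathcal{D}}(X,\Sigma^2Y)$ is injective. Furthermore, the following statements are equivalent: 1. the functor $F$ is full; 2. the functor $F$ is an equivalence; 3. the canonical maps $\theta^n_{X,Y}$ are isomorphisms of groups for all $n\geq 1$ and all $X,Y\in\mathcal{A}$; 4. the canonical maps $\theta^n_{X,Y}$ are surjective for all $n\geq 1$ and all $X,Y\in\mathcal{A}$. -/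

import Mathlib

open CategoryTheory Category Limits Pretriangulated Triangulated

universe w v' u' v u

namespace CanonicalMaps

section Heart

variable {D : Type u} [Category.{v} D] [Preadditive D] [HasZeroObject D] [HasShift D ℤ]
  [∀ n : ℤ, (shiftFunctor D n).Additive] [Pretriangulated D]
  (t : TStructure D)

section

variable (A : Type u') [Category.{v'} A] [Preadditive A] [t.Heart A]

lemma hom_shift_eq_zero ⦃X Y : A⦄ ⦃n : ℤ⦄
    (f : t.ιHeart.obj X ⟶ (t.ιHeart.obj Y)⟦n⟧) (hn : n < 0) : f = 0 := by
  have : t.IsGE ((t.ιHeart.obj Y)⟦n⟧) (-n) := t.isGE_shift _ 0 n (-n) (by lia)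
  exact t.zero f 0 (-n) (by lia)

lemma exists_heart_iso (Z : D) (h₁ : t.IsLE Z 0) (h₂ : t.IsGE Z 0) :
    ∃ X : A, Nonempty (t.ιHeart.obj X ≅ Z) := by
  have : (t.ιHeart (H := A)).essImage Z := by
    rw [t.essImage_ιHeart A]; exact ⟨h₁.le, h₂.ge⟩
  exact this

/-- Every morphism of the heart is admissible in the sense of
Beilinson, Bernstein, Deligne and Gabber. -/
lemma admissible_eq_top [IsTriangulated D] :
    AbelianSubcategory.admissibleMorphism (t.ιHeart (H := A)) = ⊤ := by
  ext X₁ X₂ f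
  simp only [MorphismProperty.top_apply, iff_true]
  intro C f₂ f₃ hT
  have hrot := rot_of_distTriang _ hT
  have hLE' : t.IsLE ((t.ιHeart.obj X₁)⟦(1 : ℤ)⟧) 0 := by
    have := t.isLE_shift (t.ιHeart.obj X₁) 0 1 (-1) (by lia)
    exact t.isLE_of_le _ (-1) 0 (by lia)
  have hGE' : t.IsGE ((t.ιHeart.obj X₁)⟦(1 : ℤ)⟧) (-1) :=
    t.isGE_shift (t.ιHeart.obj X₁) 0 1 (-1) (by lia)
  have hLE : t.IsLE C 0 := t.isLE₂ _ hrot 0 (inferInstanceAs (t.IsLE (t.ιHeart.obj X₂) 0)) hLE'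
  have hGE : t.IsGE C (-1) := t.isGE₂ _ hrot (-1)
    (t.isGE_of_ge (t.ιHeart.obj X₂) (-1) 0 (by lia)) hGE'
  have hK : t.IsGE ((t.truncLE (-1)).obj C) (-1) := inferInstance
  have hQ : t.IsLE ((t.truncGE 0).obj C) 0 := inferInstance
  have hK₁ : t.IsLE (((t.truncLE (-1)).obj C)⟦(-1 : ℤ)⟧) 0 := t.isLE_shift _ (-1) (-1) 0 (by lia)
  have hK₂ : t.IsGE (((t.truncLE (-1)).obj C)⟦(-1 : ℤ)⟧) 0 := t.isGE_shift _ (-1) (-1) 0 (by lia)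
  obtain ⟨K, ⟨eK⟩⟩ := exists_heart_iso t A _ hK₁ hK₂
  obtain ⟨Q, ⟨eQ⟩⟩ := exists_heart_iso t A ((t.truncGE 0).obj C) hQ inferInstance
  let e₁ : (t.ιHeart.obj K)⟦(1 : ℤ)⟧ ≅ (t.truncLE (-1)).obj C :=
    (shiftFunctor D (1 : ℤ)).mapIso eK ≪≫ (shiftEquiv D (1 : ℤ)).counitIso.app _
  have hTr := t.triangleLEGE_distinguished (-1) 0 (by lia) C
  refine ⟨K, Q, e₁.hom ≫ (t.truncLEι (-1)).app C, (t.truncGEπ 0).app C ≫ eQ.inv,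
    eQ.hom ≫ (t.truncGEδLE (-1) 0 (by lia)).app C ≫ e₁.inv⟦(1 : ℤ)⟧',
    isomorphic_distinguished _ hTr _ ?_⟩
  refine Triangle.isoMk _ _ e₁ (Iso.refl _) eQ ?_ ?_ ?_
  · exact Category.comp_id _
  · exact ((Category.assoc _ _ _).trans ((congrArg _ eQ.inv_hom_id).trans
      (Category.comp_id _))).trans (Category.id_comp _).symm
  · change (eQ.hom ≫ (t.truncGEδLE (-1) 0 (by lia)).app C ≫ e₁.inv⟦(1 : ℤ)⟧') ≫
      e₁.hom⟦(1 : ℤ)⟧' = eQ.hom ≫ (t.truncGEδLE (-1) 0 (by lia)).app C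
    rw [Category.assoc, Category.assoc, ← Functor.map_comp, e₁.inv_hom_id,
      CategoryTheory.Functor.map_id]
    exact congrArg _ (Category.comp_id _)

end

variable [IsTriangulated D]

instance : t.heart.IsClosedUnderBinaryProducts where
  limitsOfShape_le := by
    rintro X ⟨p⟩
    have h₁ := p.prop_diag_obj (.mk .left)
    have h₂ := p.prop_diag_obj (.mk .right)
    rw [t.mem_heart_iff] at h₁ h₂
    have hT := binaryProductTriangle_distinguished (p.diag.obj (.mk .left))
      (p.diag.obj (.mk .right))
    have e := IsLimit.conePointUniqueUpToIso (prodIsProd _ _)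
      ((IsLimit.postcomposeHomEquiv (diagramIsoPair p.diag) _).2 p.isLimit)
    refine t.heart.prop_of_iso e ?_
    rw [t.mem_heart_iff]
    exact ⟨t.isLE₂ _ hT 0 h₁.1 h₂.1, t.isGE₂ _ hT 0 h₁.2 h₂.2⟩

instance : t.heart.ContainsZero where
  exists_zero := by
    obtain ⟨Z, hZ⟩ := HasZeroObject.zero (C := D)
    exact ⟨Z, hZ, (t.mem_heart_iff Z).2 ⟨t.isLE_of_isZero hZ 0, t.isGE_of_isZero hZ 0⟩⟩

instance : t.heart.IsClosedUnderFiniteProducts := .mk'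

/-- The heart of a t-structure, as an abstract category, is the full subcategory of its objects. -/
noncomputable instance : t.Heart t.heart.FullSubcategory := t.hasHeartFullSubcategory

/-- The heart of a t-structure is an abelian category. -/
noncomputable instance : Abelian t.heart.FullSubcategory :=
  AbelianSubcategory.abelian (t.ιHeart (H := t.heart.FullSubcategory))
    (hom_shift_eq_zero t _) (admissible_eq_top t _)


end Heart
section Yoneda

variable {A : Type u} [Category.{v} A] [Abelian A]

/-- A short exact sequence `0 ⟶ Y ⟶ E ⟶ X ⟶ 0`. -/
structure SES (X Y : A) where
  /-- the middle term -/
  E : A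
  /-- the monomorphism -/
  f : Y ⟶ E
  /-- the epimorphism -/
  g : E ⟶ X
  zero : f ≫ g = 0
  shortExact : (ShortComplex.mk f g zero).ShortExact

namespace SES

instance {X Y : A} (S : SES X Y) : Mono S.f := S.shortExact.mono_f
instance {X Y : A} (S : SES X Y) : Epi S.g := S.shortExact.epi_g

/-- There is a morphism of short exact sequences from `S` to `S'` which is `α` on the right
end terms and `β` on the left end terms. -/
def HasMap {X Y X' Y' : A} (S : SES X Y) (S' : SES X' Y') (α : X ⟶ X') (β : Y ⟶ Y') : Prop :=
  ∃ ε : S.E ⟶ S'.E, S.f ≫ ε = β ≫ S'.f ∧ S.g ≫ α = ε ≫ S'.g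

lemma HasMap.refl {X Y : A} (S : SES X Y) : S.HasMap S (𝟙 X) (𝟙 Y) := ⟨𝟙 _, by simp, by simp⟩

/-- The direct sum of two short exact sequences. -/
noncomputable abbrev sum {X Y X' Y' : A} (S : SES X Y) (S' : SES X' Y') :
    SES (X ⊞ X') (Y ⊞ Y') where
  E := S.E ⊞ S'.E
  f := biprod.map S.f S'.f
  g := biprod.map S.g S'.g
  zero := by ext <;> simp [S.zero, S'.zero]
  shortExact :=
    { exact := by
        refine ShortComplex.exact_of_f_is_kernel _ (KernelFork.IsLimit.ofι' _ _ fun {T} k hk => ?_)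
        have h₁ : (k ≫ biprod.fst) ≫ S.g = 0 := by
          simpa using congrArg (fun q : _ ⟶ X ⊞ X' => q ≫ biprod.fst) hk
        have h₂ : (k ≫ biprod.snd) ≫ S'.g = 0 := by
          simpa using congrArg (fun q : _ ⟶ X ⊞ X' => q ≫ biprod.snd) hk
        refine ⟨biprod.lift (S.shortExact.exact.lift _ h₁) (S'.shortExact.exact.lift _ h₂), ?_⟩
        have e₁ := S.shortExact.exact.lift_f _ h₁
        have e₂ := S'.shortExact.exact.lift_f _ h₂
        ext
        · simpa using e₁
        · simpa using e₂
      mono_f := by dsimp; infer_instance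
      epi_g := by dsimp; infer_instance }

/-- The pushout of a short exact sequence along a morphism from its left end term. -/
noncomputable abbrev push {X Y Y' : A} (S : SES X Y) (β : Y ⟶ Y') : SES X Y' where
  E := pushout S.f β
  f := pushout.inr S.f β
  g := pushout.desc S.g 0 (by simp [S.zero])
  zero := pushout.inr_desc _ _ _
  shortExact := by
    have hepi : Epi (pushout.desc S.g 0 (by simp [S.zero]) : pushout S.f β ⟶ X) := by
      have : Epi (pushout.inl S.f β ≫ pushout.desc S.g 0 (by simp [S.zero]) : S.E ⟶ X) := by
        rw [pushout.inl_desc]; infer_instance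
      exact epi_of_epi (pushout.inl S.f β) _
    refine { exact := ?_, mono_f := by dsimp; infer_instance, epi_g := hepi }
    refine ShortComplex.exact_of_g_is_cokernel _
      (CokernelCofork.IsColimit.ofπ _ _ (fun {T} k hk => S.shortExact.exact.desc
        (pushout.inl S.f β ≫ k) ?_) (fun {T} k hk => ?_) (fun {T} k hk m hm => ?_))
    · change S.f ≫ pushout.inl S.f β ≫ k = 0
      rw [pushout.condition_assoc]
      exact (congrArg (fun q => β ≫ q) hk).trans comp_zero
    · apply pushout.hom_ext
      · exact (pushout.inl_desc_assoc _ _ _ _).trans (S.shortExact.exact.g_desc _ _)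
      · exact ((pushout.inr_desc_assoc _ _ _ _).trans zero_comp).trans hk.symm
    · refine hepi.left_cancellation _ _ (hm.trans ?_)
      apply pushout.hom_ext
      · exact ((pushout.inl_desc_assoc _ _ _ _).trans (S.shortExact.exact.g_desc _ _)).symm
      · exact (((pushout.inr_desc_assoc _ _ _ _).trans zero_comp).trans hk.symm).symm

/-- The pullback of a short exact sequence along a morphism to its right end term. -/
noncomputable abbrev pull {X X' Y : A} (S : SES X Y) (α : X' ⟶ X) : SES X' Y where
  E := pullback S.g α
  f := pullback.lift S.f 0 (by simp [S.zero])
  g := pullback.snd S.g α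
  zero := pullback.lift_snd _ _ _
  shortExact := by
    have hmono : Mono (pullback.lift S.f 0 (by simp [S.zero]) : Y ⟶ pullback S.g α) := by
      have : Mono (pullback.lift S.f 0 (by simp [S.zero]) ≫ pullback.fst S.g α : Y ⟶ S.E) := by
        rw [pullback.lift_fst]; infer_instance
      exact mono_of_mono _ (pullback.fst S.g α)
    refine { exact := ?_, mono_f := hmono, epi_g := by dsimp; infer_instance }
    have key : ∀ {T : A} (k : T ⟶ pullback S.g α) (_ : k ≫ pullback.snd S.g α = 0),
        ∃ l : T ⟶ Y, l ≫ pullback.lift S.f 0 (by simp [S.zero]) = k := by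
      intro T k hk
      have h : (k ≫ pullback.fst S.g α) ≫ S.g = 0 := by
        rw [assoc, pullback.condition, reassoc_of% hk, zero_comp]
      refine ⟨S.shortExact.exact.lift _ h, ?_⟩
      apply pullback.hom_ext
      · rw [assoc, pullback.lift_fst]
        exact S.shortExact.exact.lift_f _ h
      · rw [assoc, pullback.lift_snd, comp_zero, hk]
    exact ShortComplex.exact_of_f_is_kernel _ (KernelFork.IsLimit.ofι _ _
      (fun k hk => (key k hk).choose) (fun k hk => (key k hk).choose_spec)
      (fun k hk m hm => hmono.right_cancellation _ _ (hm.trans (key k hk).choose_spec.symm)))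

lemma HasMap.sum {X Y X' Y' Z W Z' W' : A} {S : SES X Y} {S' : SES X' Y'} {T : SES Z W}
    {T' : SES Z' W'} {α : X ⟶ X'} {β : Y ⟶ Y'} {γ : Z ⟶ Z'} {δ : W ⟶ W'}
    (h : S.HasMap S' α β) (h' : T.HasMap T' γ δ) :
    (S.sum T).HasMap (S'.sum T') (biprod.map α γ) (biprod.map β δ) := by
  obtain ⟨ε, h₁, h₂⟩ := h
  obtain ⟨ε', h₁', h₂'⟩ := h'
  refine ⟨biprod.map ε ε', ?_, ?_⟩
  · ext <;> simp [h₁, h₁']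
  · ext <;> simp [h₂, h₂']

lemma HasMap.push {X Y Z X' Y' Z' : A} {S : SES X Y} {S' : SES X' Y'} {α : X ⟶ X'}
    {β : Y ⟶ Y'} (h : S.HasMap S' α β) (γ : Y ⟶ Z) (γ' : Y' ⟶ Z') (δ : Z ⟶ Z')
    (w : γ ≫ δ = β ≫ γ') : (S.push γ).HasMap (S'.push γ') α δ := by
  obtain ⟨ε, h₁, h₂⟩ := h
  have hε : S.f ≫ ε ≫ pushout.inl S'.f γ' = γ ≫ δ ≫ pushout.inr S'.f γ' := by
    rw [reassoc_of% h₁, pushout.condition, reassoc_of% w]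
  refine ⟨pushout.desc _ _ hε, pushout.inr_desc _ _ _, ?_⟩
  apply pushout.hom_ext
  · rw [pushout.inl_desc_assoc, pushout.inl_desc_assoc, assoc, pushout.inl_desc, h₂]
  · rw [pushout.inr_desc_assoc, pushout.inr_desc_assoc, assoc, pushout.inr_desc, zero_comp,
      comp_zero]

lemma HasMap.pull {X Y Z X' Y' Z' : A} {S : SES X Y} {S' : SES X' Y'} {α : X ⟶ X'}
    {β : Y ⟶ Y'} (h : S.HasMap S' α β) (γ : Z ⟶ X) (γ' : Z' ⟶ X') (δ : Z ⟶ Z')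
    (w : γ ≫ α = δ ≫ γ') : (S.pull γ).HasMap (S'.pull γ') δ β := by
  obtain ⟨ε, h₁, h₂⟩ := h
  have hε : (pullback.fst S.g γ ≫ ε) ≫ S'.g = (pullback.snd S.g γ ≫ δ) ≫ γ' := by
    rw [assoc, ← h₂, pullback.condition_assoc, w, assoc]
  refine ⟨pullback.lift _ _ hε, ?_, (pullback.lift_snd _ _ _).symm⟩
  apply pullback.hom_ext
  · rw [assoc, assoc, pullback.lift_fst, pullback.lift_fst_assoc, pullback.lift_fst, h₁]
  · rw [assoc, assoc, pullback.lift_snd, pullback.lift_snd_assoc, pullback.lift_snd, zero_comp,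
      comp_zero]

end SES

/-- An `n`-fold extension of `X` by `Y`, for `n ≥ 1`, that is, an exact sequence
`0 ⟶ Y ⟶ E_{n-1} ⟶ ⋯ ⟶ E_0 ⟶ X ⟶ 0`, presented as the splice of the `n` short exact sequences
into which it breaks up: `splice S ξ` is the sequence obtained by splicing
`0 ⟶ Y ⟶ E_{n+1} ⟶ Z ⟶ 0` with `0 ⟶ Z ⟶ E_n ⟶ ⋯ ⟶ E_0 ⟶ X ⟶ 0`. (For `n = 0` there is none.) -/
inductive NExtension : ℕ → A → A → Type max u v
  | single {X Y : A} (S : SES X Y) : NExtension 1 X Y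
  | splice {n : ℕ} {X Z Y : A} (S : SES Z Y) (ξ : NExtension (n + 1) X Z) : NExtension (n + 2) X Y

namespace NExtension

/-- There is a morphism of exact sequences from `ξ` to `ξ'` which is `α` on the right
end terms and `β` on the left end terms. (Such a morphism induces morphisms on the images of the
differentials, so that it is a chain of morphisms of short exact sequences.) -/
inductive HasMap : ∀ {n : ℕ} {X Y X' Y' : A},
    NExtension n X Y → NExtension n X' Y' → (X ⟶ X') → (Y ⟶ Y') → Prop
  | single {X Y X' Y' : A} {S : SES X Y} {S' : SES X' Y'} {α : X ⟶ X'} {β : Y ⟶ Y'}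
      (h : S.HasMap S' α β) : HasMap (.single S) (.single S') α β
  | splice {n : ℕ} {X Y Z X' Y' Z' : A} {S : SES Z Y} {S' : SES Z' Y'}
      {ξ : NExtension (n + 1) X Z} {ξ' : NExtension (n + 1) X' Z'}
      {α : X ⟶ X'} {β : Y ⟶ Y'} (ζ : Z ⟶ Z') (h : S.HasMap S' ζ β) (h' : HasMap ξ ξ' α ζ) :
      HasMap (.splice S ξ) (.splice S' ξ') α β

/-- The direct sum of two `n`-fold extensions. -/
noncomputable def sum : ∀ {n : ℕ} {X Y X' Y' : A},
    NExtension n X Y → NExtension n X' Y' → NExtension n (X ⊞ X') (Y ⊞ Y')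
  | _, _, _, _, _, .single S, .single S' => .single (S.sum S')
  | _, _, _, _, _, .splice S ξ, .splice S' ξ' => .splice (S.sum S') (ξ.sum ξ')

/-- The pushout of an `n`-fold extension along a morphism from its left end term. -/
noncomputable def push : ∀ {n : ℕ} {X Y Y' : A},
    NExtension n X Y → (Y ⟶ Y') → NExtension n X Y'
  | _, _, _, _, .single S, β => .single (S.push β)
  | _, _, _, _, .splice S ξ, β => .splice (S.push β) ξ

/-- The pullback of an `n`-fold extension along a morphism to its right end term. -/
noncomputable def pull : ∀ {n : ℕ} {X X' Y : A},
    NExtension n X Y → (X' ⟶ X) → NExtension n X' Y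
  | _, _, _, _, .single S, α => .single (S.pull α)
  | _, _, _, _, .splice S ξ, α => .splice S (ξ.pull α)

lemma HasMap.refl {n : ℕ} {X Y : A} (ξ : NExtension n X Y) : HasMap ξ ξ (𝟙 X) (𝟙 Y) := by
  induction ξ with
  | single S => exact .single (.refl S)
  | splice S ξ h => exact .splice (𝟙 _) (.refl S) h

lemma HasMap.sum {n : ℕ} {X Y X' Y' Z W Z' W' : A} {ξ : NExtension n X Y}
    {ξ' : NExtension n X' Y'} {η : NExtension n Z W} {η' : NExtension n Z' W'}
    {α : X ⟶ X'} {β : Y ⟶ Y'} {γ : Z ⟶ Z'} {δ : W ⟶ W'}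
    (h : HasMap ξ ξ' α β) (h' : HasMap η η' γ δ) :
    HasMap (ξ.sum η) (ξ'.sum η') (biprod.map α γ) (biprod.map β δ) := by
  induction h generalizing Z W Z' W' with
  | single h =>
    cases h' with
    | single h' => exact .single (h.sum h')
  | splice ζ h₁ h₂ ih =>
    cases h' with
    | splice ζ' h₁' h₂' => exact .splice _ (h₁.sum h₁') (ih h₂')

lemma HasMap.push {n : ℕ} {X Y Z X' Y' Z' : A} {ξ : NExtension n X Y} {ξ' : NExtension n X' Y'}
    {α : X ⟶ X'} {β : Y ⟶ Y'} (h : HasMap ξ ξ' α β) (γ : Y ⟶ Z) (γ' : Y' ⟶ Z') (δ : Z ⟶ Z')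
    (w : γ ≫ δ = β ≫ γ') : HasMap (ξ.push γ) (ξ'.push γ') α δ := by
  cases h with
  | single h => exact .single (h.push γ γ' δ w)
  | splice ζ h₁ h₂ => exact .splice ζ (h₁.push γ γ' δ w) h₂

lemma HasMap.pull {n : ℕ} {X Y Z X' Y' Z' : A} {ξ : NExtension n X Y} {ξ' : NExtension n X' Y'}
    {α : X ⟶ X'} {β : Y ⟶ Y'} (h : HasMap ξ ξ' α β) (γ : Z ⟶ X) (γ' : Z' ⟶ X') (δ : Z ⟶ Z')
    (w : γ ≫ α = δ ≫ γ') : HasMap (ξ.pull γ) (ξ'.pull γ') δ β := by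
  induction h with
  | single h => exact .single (h.pull γ γ' δ w)
  | splice ζ h₁ h₂ ih => exact .splice ζ h₁ (ih γ γ' w)

/-- The Baer sum of two `n`-fold extensions of `X` by `Y`: the pullback along the diagonal of `X`
and the pushout along the codiagonal of `Y` of their direct sum. -/
noncomputable def baerSum {n : ℕ} {X Y : A} (ξ ξ' : NExtension n X Y) : NExtension n X Y :=
  ((ξ.sum ξ').pull (biprod.lift (𝟙 X) (𝟙 X))).push (biprod.desc (𝟙 Y) (𝟙 Y))

lemma HasMap.baerSum {n : ℕ} {X Y : A} {ξ ξ' η η' : NExtension n X Y}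
    (h : HasMap ξ ξ' (𝟙 X) (𝟙 Y)) (h' : HasMap η η' (𝟙 X) (𝟙 Y)) :
    HasMap (ξ.baerSum η) (ξ'.baerSum η') (𝟙 X) (𝟙 Y) :=
  ((h.sum h').pull _ _ (𝟙 X) (by ext <;> simp)).push _ _ (𝟙 Y) (by ext <;> simp)

end NExtension

/-- The Yoneda extension group `Yextⁿ(X, Y)` for `n ≥ 1`: the `n`-fold extensions of `X` by `Y`
modulo the equivalence relation generated by the morphisms of exact sequences which are
the identity on both end terms. -/
def Yext (n : ℕ) (X Y : A) : Type max u v :=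
  Quot fun ξ ξ' : NExtension n X Y => NExtension.HasMap ξ ξ' (𝟙 X) (𝟙 Y)

/-- The addition of `Yextⁿ(X, Y)` is the Baer sum. -/
noncomputable instance (n : ℕ) (X Y : A) : Add (Yext n X Y) where
  add := Quot.map₂ NExtension.baerSum
    (fun ξ _ _ h => (NExtension.HasMap.refl ξ).baerSum h)
    (fun _ _ ξ h => h.baerSum (NExtension.HasMap.refl ξ))

end Yoneda

section Theta

variable {D : Type u} [Category.{v} D] [Preadditive D] [HasZeroObject D] [HasShift D ℤ]
  [∀ n : ℤ, (shiftFunctor D n).Additive] [Pretriangulated D]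
  (t : TStructure D) {A : Type u'} [Category.{v'} A] [Abelian A] [t.Heart A]

lemma comm_of_hasMap {X Y X' Y' : A} {S : SES X Y} {S' : SES X' Y'} {α : X ⟶ X'} {β : Y ⟶ Y'}
    (h : S.HasMap S' α β) (δ : ShiftedHom (t.ιHeart.obj X) (t.ιHeart.obj Y) (1 : ℤ))
    (hδ : Triangle.mk (t.ιHeart.map S.f) (t.ιHeart.map S.g) δ ∈ distTriang D)
    (δ' : ShiftedHom (t.ιHeart.obj X') (t.ιHeart.obj Y') (1 : ℤ))
    (hδ' : Triangle.mk (t.ιHeart.map S'.f) (t.ιHeart.map S'.g) δ' ∈ distTriang D) :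
    δ ≫ (t.ιHeart.map β)⟦(1 : ℤ)⟧' = t.ιHeart.map α ≫ δ' := by
  obtain ⟨ε, h₁, h₂⟩ := h
  obtain ⟨c, hc₂, hc₃⟩ := complete_distinguished_triangle_morphism _ _ hδ hδ'
    (t.ιHeart.map β) (t.ιHeart.map ε) (by
      change t.ιHeart.map S.f ≫ t.ιHeart.map ε = t.ιHeart.map β ≫ t.ιHeart.map S'.f
      rw [← Functor.map_comp, ← Functor.map_comp, h₁])
  obtain ⟨γ, rfl⟩ := t.ιHeart.map_surjective c
  have hγ : γ = α := by
    rw [← cancel_epi S.g]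
    apply t.ιHeart.map_injective
    have : t.ιHeart.map S.g ≫ t.ιHeart.map γ = t.ιHeart.map ε ≫ t.ιHeart.map S'.g := hc₂
    rw [Functor.map_comp, this, h₂, Functor.map_comp]
  subst hγ
  exact hc₃

variable [IsTriangulated D]

/-- A short exact sequence `0 ⟶ Y ⟶ E ⟶ X ⟶ 0` in the heart fits into
a distinguished triangle `Y ⟶ E ⟶ X ⟶ Y⟦1⟧`. -/
lemma exists_delta {X Y : A} (S : SES X Y) :
    ∃ δ : ShiftedHom (t.ιHeart.obj X) (t.ιHeart.obj Y) (1 : ℤ),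
      Triangle.mk (t.ιHeart.map S.f) (t.ιHeart.map S.g) δ ∈ distTriang D := by
  obtain ⟨K, i, δ, hT⟩ := AbelianSubcategory.exists_distinguished_triangle_of_epi
    (ι := t.ιHeart (H := A)) (hom_shift_eq_zero t A) (admissible_eq_top t A) S.g
  have hK := AbelianSubcategory.isLimitKernelForkOfDistTriang
    (hom_shift_eq_zero t A) i S.g δ hT
  have hY := S.shortExact.fIsKernel
  let e : Y ≅ K := IsLimit.conePointUniqueUpToIso hY hK
  have he : e.hom ≫ i = S.f := IsLimit.conePointUniqueUpToIso_hom_comp hY hK .zero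
  refine ⟨δ ≫ (t.ιHeart.map e.inv)⟦(1 : ℤ)⟧', isomorphic_distinguished _ hT _ ?_⟩
  refine Triangle.isoMk _ _ (t.ιHeart.mapIso e) (Iso.refl _) (Iso.refl _) ?_ ?_ ?_
  · change t.ιHeart.map S.f ≫ 𝟙 _ = t.ιHeart.map e.hom ≫ t.ιHeart.map i
    rw [← Functor.map_comp, he, comp_id]
  · exact (comp_id _).trans (id_comp _).symm
  · change (δ ≫ (t.ιHeart.map e.inv)⟦(1 : ℤ)⟧') ≫ (t.ιHeart.map e.hom)⟦(1 : ℤ)⟧' = 𝟙 _ ≫ δ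
    rw [assoc, ← Functor.map_comp, ← Functor.map_comp, e.inv_hom_id]
    simp

/-- The morphism `θ¹(S)`, i.e. the unique morphism `X ⟶ Y⟦1⟧` which makes
`Y ⟶ E ⟶ X ⟶ Y⟦1⟧` a distinguished triangle. -/
noncomputable def SES.theta {X Y : A} (S : SES X Y) :
    ShiftedHom (t.ιHeart.obj X) (t.ιHeart.obj Y) (1 : ℤ) :=
  (exists_delta t S).choose

lemma SES.theta_distinguished {X Y : A} (S : SES X Y) :
    Triangle.mk (t.ιHeart.map S.f) (t.ιHeart.map S.g) (S.theta t) ∈ distTriang D :=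
  (exists_delta t S).choose_spec

lemma SES.theta_eq {X Y : A} (S : SES X Y)
    (δ : ShiftedHom (t.ιHeart.obj X) (t.ιHeart.obj Y) (1 : ℤ))
    (hδ : Triangle.mk (t.ιHeart.map S.f) (t.ιHeart.map S.g) δ ∈ distTriang D) :
    S.theta t = δ := by
  simpa using comm_of_hasMap t (.refl S) _ (S.theta_distinguished t) δ hδ

/-- The canonical map on `n`-fold extensions: `θ¹(S)` is defined above and, if `S ∪ ξ` is
the splice of `S` and `ξ`, then `θⁿ⁺¹(S ∪ ξ) : X ⟶ Y⟦n + 1⟧` is the composition of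
`θⁿ(ξ) : X ⟶ Z⟦n⟧` and `θ¹(S)⟦n⟧ : Z⟦n⟧ ⟶ Y⟦1⟧⟦n⟧`. -/
noncomputable def NExtension.theta : ∀ {n : ℕ} {X Y : A}, NExtension n X Y →
    ShiftedHom (t.ιHeart.obj X) (t.ιHeart.obj Y) (n : ℤ)
  | _, _, _, .single S => (S.theta t : ShiftedHom _ _ (1 : ℤ))
  | _, _, _, .splice (n := n) S ξ =>
      ShiftedHom.comp ξ.theta (S.theta t) (show (1 : ℤ) + ((n + 1 : ℕ) : ℤ) = ((n + 2 : ℕ) : ℤ) by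
        push_cast; ring)

lemma NExtension.theta_naturality {n : ℕ} {X Y X' Y' : A} {ξ : NExtension n X Y}
    {ξ' : NExtension n X' Y'} {α : X ⟶ X'} {β : Y ⟶ Y'} (h : HasMap ξ ξ' α β) :
    ξ.theta t ≫ (t.ιHeart.map β)⟦(n : ℤ)⟧' = t.ιHeart.map α ≫ ξ'.theta t := by
  induction h with
  | single h =>
    exact comm_of_hasMap t h _ (SES.theta_distinguished t _) _ (SES.theta_distinguished t _)
  | splice ζ h h' ih =>
    have h₁ := comm_of_hasMap t h _ (SES.theta_distinguished t _) _ (SES.theta_distinguished t _)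
    rw [← ShiftedHom.comp_mk₀ _ (0 : ℤ) rfl, ← ShiftedHom.mk₀_comp (0 : ℤ) rfl] at ih h₁ ⊢
    simp only [NExtension.theta]
    rw [ShiftedHom.comp_assoc _ _ _ _ (zero_add _) (by push_cast; ring), h₁,
      ← ShiftedHom.comp_assoc _ _ _ (zero_add _) (add_zero _) (by push_cast; ring), ih,
      ShiftedHom.comp_assoc]
    push_cast; ring

/-- The canonical map `θⁿ : Yextⁿ(X, Y) ⟶ Hom_D(X, Y⟦n⟧)` attached to a t-structure on `D` with
heart `A`. -/
noncomputable def theta (n : ℕ) (X Y : A) :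
    Yext n X Y → ShiftedHom (t.ιHeart.obj X) (t.ιHeart.obj Y) (n : ℤ) :=
  Quot.lift (NExtension.theta t) fun _ _ h => by simpa using NExtension.theta_naturality t h

end Theta

section DerivedCategory

variable (A : Type u) [Category.{v} A] [Abelian A] [HasDerivedCategory.{w} A]

/-- The functor `A ⥤ Dᵇ(A)` which sends an object to the stalk complex in degree `0`. -/
noncomputable abbrev stalk : A ⥤ DerivedCategory.Bounded A :=
  ObjectProperty.lift _ (DerivedCategory.singleFunctor A 0) fun _ =>
    ⟨⟨0, inferInstance⟩, ⟨0, inferInstance⟩⟩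

/-- The canonical t-structure on `Dᵇ(A)`. -/
noncomputable abbrev tCan : TStructure (DerivedCategory.Bounded A) :=
  (DerivedCategory.TStructure.t (C := A)).onBounded

/-- The abelian category `A` is identified by `stalk` to the heart of the canonical t-structure
on `Dᵇ(A)`. -/
noncomputable instance : (tCan A).Heart A where
  ι := stalk A
  additive_ι :=
    ⟨fun {X Y f g} => (DerivedCategory.Bounded.ι (C := A)).map_injective
      ((DerivedCategory.singleFunctor A 0).map_add (f := f) (g := g))⟩
  full_ι := ⟨fun {X Y} f => by
    obtain ⟨g, hg⟩ := (DerivedCategory.singleFunctor A 0).map_surjective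
      ((DerivedCategory.Bounded.ι (C := A)).map f)
    exact ⟨g, (DerivedCategory.Bounded.ι (C := A)).map_injective hg⟩⟩
  faithful_ι := ⟨fun {X Y f g} h => (DerivedCategory.singleFunctor A 0).map_injective
    (congrArg (DerivedCategory.Bounded.ι (C := A)).map h)⟩
  essImage_eq_heart := by
    ext X
    constructor
    · rintro ⟨Y, ⟨e⟩⟩
      refine (tCan A).heart.prop_of_iso e ⟨?_, ?_⟩
      · exact DerivedCategory.TStructure.t.le_of_isLE ((DerivedCategory.singleFunctor A 0).obj Y) 0
      · exact DerivedCategory.TStructure.t.ge_of_isGE ((DerivedCategory.singleFunctor A 0).obj Y) 0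
    · rintro ⟨h₁, h₂⟩
      have : X.obj.IsLE 0 := ⟨h₁⟩
      have : X.obj.IsGE 0 := ⟨h₂⟩
      obtain ⟨Y, ⟨e⟩⟩ := X.obj.exists_iso_singleFunctor_obj_of_isGE_of_isLE 0
      exact ⟨Y, ⟨(DerivedCategory.Bounded.ι (C := A)).preimageIso e.symm⟩⟩

end DerivedCategory

section Realization

variable {D : Type u} [Category.{v} D] [Preadditive D] [HasZeroObject D] [HasShift D ℤ]
  [∀ n : ℤ, (shiftFunctor D n).Additive] [Pretriangulated D] [IsTriangulated D]

/-- A realization functor of a t-structure on `D` with heart `A`: a triangle functor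
`F : Dᵇ(A) ⥤ D` (the natural isomorphism `ω` is part of the datum `commShift`) whose restriction
to `A` is identified with the inclusion of `A` in `D`. -/
structure RealizationFunctor (t : TStructure D) [HasDerivedCategory.{w} t.heart.FullSubcategory] where
  /-- the underlying functor -/
  F : DerivedCategory.Bounded t.heart.FullSubcategory ⥤ D
  /-- the compatibility of `F` with the translation functors -/
  [commShift : F.CommShift ℤ]
  [isTriangulated : F.IsTriangulated]
  /-- the identification of the restriction of `F` to the heart with the inclusion functor -/
  iso : (tCan t.heart.FullSubcategory).ιHeart (H := t.heart.FullSubcategory) ⋙ F ≅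
    t.ιHeart (H := t.heart.FullSubcategory)

attribute [instance] RealizationFunctor.commShift RealizationFunctor.isTriangulated

/-- The group `Extⁿ(X, Y) = Hom(X, Y⟦n⟧)` in `Dᵇ(A)`, for `X` and `Y` in `A`. -/
abbrev DExt {A : Type u} [Category.{v} A] [Abelian A] [HasDerivedCategory.{w} A]
    (n : ℕ) (X Y : A) : Type w :=
  ShiftedHom ((tCan A).ιHeart.obj X) ((tCan A).ιHeart.obj Y) (n : ℤ)

/-- The canonical map `χⁿ : Yextⁿ(X, Y) ⟶ Extⁿ(X, Y)`, i.e. the canonical map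
attached to the canonical t-structure on `Dᵇ(A)`. -/
noncomputable abbrev chi {A : Type u} [Category.{v} A] [Abelian A] [HasDerivedCategory.{w} A]
    (n : ℕ) (X Y : A) : Yext n X Y → DExt.{w} n X Y :=
  theta (tCan A) n X Y

namespace RealizationFunctor

variable {t : TStructure D} [HasDerivedCategory.{w} t.heart.FullSubcategory]

/-- The map `Extⁿ(X, Y) ⟶ Hom_D(X, Y⟦n⟧)` induced by a realization functor `(F, ω)`: it sends
`f : X ⟶ Y⟦n⟧` to `F(f)` followed by `ωⁿ : F(Y⟦n⟧) ≅ F(Y)⟦n⟧`, where `F(X)` and `F(Y)` are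
identified with `X` and `Y`. -/
noncomputable def extMap (F : RealizationFunctor.{w} t) (n : ℕ) (X Y : t.heart.FullSubcategory) :
    DExt.{w} n X Y →+ ShiftedHom (t.ιHeart.obj X) (t.ιHeart.obj Y) (n : ℤ) where
  toFun f := F.iso.inv.app X ≫ ShiftedHom.map f F.F ≫ (F.iso.hom.app Y)⟦(n : ℤ)⟧'
  map_zero' := by simp
  map_add' f g := by simp

end RealizationFunctor

end Realization

end CanonicalMaps

namespace CanonicalMaps

section Extensions

variable {A : Type u} [Category.{v} A] [Abelian A]

/-- The short exact sequence attached to a monomorphism. -/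
noncomputable abbrev SES.ofMono {Y E : A} (f : Y ⟶ E) [Mono f] : SES (cokernel f) Y where
  E := E
  f := f
  g := cokernel.π f
  zero := cokernel.condition f
  shortExact :=
    { exact := ShortComplex.exact_cokernel f
      mono_f := by dsimp; infer_instance
      epi_g := by dsimp; infer_instance }

/-- A commutative square between the monomorphisms of two short exact sequences extends to
a morphism of short exact sequences. -/
lemma SES.exists_hasMap {X Y X' Y' : A} (S : SES X Y) (S' : SES X' Y') (β : Y ⟶ Y')
    (ε : S.E ⟶ S'.E) (h : S.f ≫ ε = β ≫ S'.f) : ∃ α, S.HasMap S' α β := by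
  have h' : S.f ≫ ε ≫ S'.g = 0 := by rw [reassoc_of% h, S'.zero, comp_zero]
  exact ⟨S.shortExact.exact.desc _ h', ε, h, S.shortExact.exact.g_desc _ h'⟩

/-- Two short exact sequences with the same left end term map to a common one. -/
lemma SES.exists_common {X X' Y : A} (S : SES X Y) (S' : SES X' Y) :
    ∃ (X'' : A) (T : SES X'' Y) (α : X ⟶ X'') (α' : X' ⟶ X''),
      S.HasMap T α (𝟙 Y) ∧ S'.HasMap T α' (𝟙 Y) := by
  have : Mono (S.f ≫ pushout.inl S.f S'.f) := mono_comp _ _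
  obtain ⟨α, hα⟩ := S.exists_hasMap (.ofMono (S.f ≫ pushout.inl S.f S'.f)) (𝟙 Y)
    (pushout.inl S.f S'.f) (by simp)
  obtain ⟨α', hα'⟩ := S'.exists_hasMap (.ofMono (S.f ≫ pushout.inl S.f S'.f)) (𝟙 Y)
    (pushout.inr S.f S'.f) (by simp [pushout.condition])
  exact ⟨_, _, α, α', hα, hα'⟩

/-- A short exact sequence maps to the one obtained by enlarging its middle term. -/
lemma SES.exists_enlarge {X Y E' : A} (S : SES X Y) (j : S.E ⟶ E') [Mono j] :
    ∃ (X' : A) (T : SES X' Y) (α : X ⟶ X') (_ : S.HasMap T α (𝟙 Y)) (e : E' ⟶ T.E),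
      S.g ≫ α = j ≫ e ≫ T.g := by
  have : Mono (S.f ≫ j) := mono_comp _ _
  have h' : S.f ≫ j ≫ cokernel.π (S.f ≫ j) = 0 := by
    rw [← assoc]; exact cokernel.condition _
  refine ⟨_, .ofMono (S.f ≫ j), S.shortExact.exact.desc _ h', ⟨j, by simp, ?_⟩, 𝟙 _, ?_⟩
  · exact S.shortExact.exact.g_desc _ h'
  · rw [id_comp]; exact S.shortExact.exact.g_desc _ h'

lemma SES.hasMap_push {X Y Y' : A} (S : SES X Y) (β : Y ⟶ Y') :
    S.HasMap (S.push β) (𝟙 X) β :=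
  ⟨pushout.inl _ _, pushout.condition, (comp_id _).trans (pushout.inl_desc _ _ _).symm⟩

lemma SES.pull_hasMap {X X' Y : A} (S : SES X Y) (α : X' ⟶ X) :
    (S.pull α).HasMap S α (𝟙 Y) :=
  ⟨pullback.fst _ _, (pullback.lift_fst _ _ _).trans (id_comp _).symm, pullback.condition.symm⟩

lemma SES.hasMap_sum_inl {X Y X' Y' : A} (S : SES X Y) (S' : SES X' Y') :
    S.HasMap (S.sum S') biprod.inl biprod.inl :=
  ⟨biprod.inl, by simp, by simp⟩

lemma SES.hasMap_sum_inr {X Y X' Y' : A} (S : SES X Y) (S' : SES X' Y') :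
    S'.HasMap (S.sum S') biprod.inr biprod.inr :=
  ⟨biprod.inr, by simp, by simp⟩

namespace NExtension

lemma hasMap_push {n : ℕ} {X Y Y' : A} (ξ : NExtension n X Y) (β : Y ⟶ Y') :
    HasMap ξ (ξ.push β) (𝟙 X) β := by
  cases ξ with
  | single S => exact .single (S.hasMap_push β)
  | splice S ξ => exact .splice _ (S.hasMap_push β) (.refl ξ)

lemma pull_hasMap {n : ℕ} {X X' Y : A} (ξ : NExtension n X Y) (α : X' ⟶ X) :
    HasMap (ξ.pull α) ξ α (𝟙 Y) := by
  induction ξ with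
  | single S => exact .single (S.pull_hasMap α)
  | splice S ξ h => exact .splice _ (.refl S) (h α)

lemma hasMap_sum_inl {n : ℕ} {X Y X' Y' : A} (ξ : NExtension n X Y) (ξ' : NExtension n X' Y') :
    HasMap ξ (ξ.sum ξ') biprod.inl biprod.inl := by
  induction ξ generalizing X' Y' with
  | single S =>
    cases ξ' with
    | single S' => exact .single (S.hasMap_sum_inl S')
  | splice S ξ h =>
    cases ξ' with
    | splice S' ξ' => exact .splice _ (S.hasMap_sum_inl S') (h ξ')

lemma hasMap_sum_inr {n : ℕ} {X Y X' Y' : A} (ξ : NExtension n X Y) (ξ' : NExtension n X' Y') :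
    HasMap ξ' (ξ.sum ξ') biprod.inr biprod.inr := by
  induction ξ generalizing X' Y' with
  | single S =>
    cases ξ' with
    | single S' => exact .single (S.hasMap_sum_inr S')
  | splice S ξ h =>
    cases ξ' with
    | splice S' ξ' => exact .splice _ (S.hasMap_sum_inr S') (h ξ')

end NExtension

/-- The class of a splice in terms of the class of its right factor. -/
def Yext.splice {n : ℕ} {X Y Z : A} (S : SES Z Y) : Yext (n + 1) X Z → Yext (n + 2) X Y :=
  Quot.map (NExtension.splice S) fun _ _ h => .splice _ (.refl S) h

/-- The pushout on classes of extensions. -/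
noncomputable def Yext.push {n : ℕ} {X Y Y' : A} (β : Y ⟶ Y') : Yext n X Y → Yext n X Y' :=
  Quot.map (fun ξ => ξ.push β) fun _ _ h => h.push β β (𝟙 Y') (by simp)

lemma Yext.splice_eq_of_hasMap {n : ℕ} {X Y Z Z' : A} {S : SES Z Y} {T : SES Z' Y} {α : Z ⟶ Z'}
    (h : S.HasMap T α (𝟙 Y)) (x : Yext (n + 1) X Z) :
    Yext.splice S x = Yext.splice T (x.push α) := by
  obtain ⟨ξ, rfl⟩ := Quot.exists_rep x
  exact Quot.sound (.splice α h (ξ.hasMap_push α))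

lemma Yext.exists_eq_splice {n : ℕ} {X Y : A} (x : Yext (n + 2) X Y) :
    ∃ (Z : A) (S : SES Z Y) (y : Yext (n + 1) X Z), x = Yext.splice S y := by
  obtain ⟨ξ, rfl⟩ := Quot.exists_rep x
  cases ξ with
  | splice S ξ => exact ⟨_, S, Quot.mk _ ξ, rfl⟩

end Extensions

section Theta

variable {D : Type u} [Category.{v} D] [Preadditive D] [HasZeroObject D] [HasShift D ℤ]
  [∀ n : ℤ, (shiftFunctor D n).Additive] [Pretriangulated D]

/-- Exactness of `Hom(X, -)` at the middle term of a shifted distinguished triangle. -/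
lemma shift_coyoneda_exact₂ {X Y E Z : D} {f : Y ⟶ E} {g : E ⟶ Z} {δ : ShiftedHom Z Y (1 : ℤ)}
    (hT : Triangle.mk f g δ ∈ distTriang D) {n m : ℤ} (h : 1 + n = m) (x : ShiftedHom X Z n)
    (hx : x.comp δ h = 0) : ∃ y : ShiftedHom X E n, x = y ≫ g⟦n⟧' := by
  have h₀ : x ≫ δ⟦n⟧' = 0 := by
    rw [← cancel_mono ((shiftFunctorAdd' D 1 n m h).inv.app Y), assoc, zero_comp]
    exact hx
  obtain ⟨y, hy⟩ := Triangle.coyoneda_exact₃ _ (Triangle.shift_distinguished _ hT n) x (by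
    change x ≫ (n.negOnePow • δ⟦n⟧' ≫ (shiftFunctorComm D 1 n).hom.app Y) = 0
    rw [Linear.comp_units_smul, reassoc_of% h₀, zero_comp, smul_zero])
  let y' : ShiftedHom X E n := y
  have hy' : x = y' ≫ (n.negOnePow • g⟦n⟧') := hy
  refine ⟨n.negOnePow • y', ?_⟩
  rw [hy', Linear.comp_units_smul, Linear.units_smul_comp]

/-- Exactness of `Hom(X, -)` at the first term of a shifted distinguished triangle. -/
lemma shift_coyoneda_exact₁ {X Y E Z : D} {f : Y ⟶ E} {g : E ⟶ Z} {δ : ShiftedHom Z Y (1 : ℤ)}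
    (hT : Triangle.mk f g δ ∈ distTriang D) {n m : ℤ} (h : 1 + n = m) (x : ShiftedHom X Y m)
    (hx : x ≫ f⟦m⟧' = 0) : ∃ y : ShiftedHom X Z n, x = y.comp δ h := by
  have h' : n + 1 = m := by lia
  obtain ⟨y, hy⟩ := Triangle.coyoneda_exact₁ _ (Triangle.shift_distinguished _ hT n)
    (x ≫ (shiftFunctorAdd' D n 1 m h').hom.app Y) (by
      change (x ≫ (shiftFunctorAdd' D n 1 m h').hom.app Y) ≫ (n.negOnePow • f⟦n⟧')⟦(1 : ℤ)⟧' = 0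
      have hn := (shiftFunctorAdd' D n 1 m h').hom.naturality f
      rw [Functor.comp_map] at hn
      rw [Functor.map_units_smul, Linear.comp_units_smul, assoc, ← hn, reassoc_of% hx, zero_comp,
        smul_zero])
  let y' : ShiftedHom X Z n := y
  have hy' : x ≫ (shiftFunctorAdd' D n 1 m h').hom.app Y =
    y' ≫ (n.negOnePow • δ⟦n⟧' ≫ (shiftFunctorComm D 1 n).hom.app Y) := hy
  refine ⟨n.negOnePow • y', ?_⟩
  rw [← cancel_mono ((shiftFunctorAdd' D n 1 m h').hom.app Y)]
  refine hy'.trans ?_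
  rw [shiftFunctorComm_eq D 1 n m h, ShiftedHom.comp]
  simp [Linear.comp_units_smul, Linear.units_smul_comp]

variable (t : TStructure D) {A : Type u'} [Category.{v'} A] [Abelian A] [t.Heart A]

/-- A distinguished triangle with terms in the heart is given by a short exact sequence. -/
lemma exists_ses_of_distTriang {X Y E : A} (f : Y ⟶ E) (g : E ⟶ X)
    (δ : ShiftedHom (t.ιHeart.obj X) (t.ιHeart.obj Y) (1 : ℤ))
    (hT : Triangle.mk (t.ιHeart.map f) (t.ιHeart.map g) δ ∈ distTriang D) :
    ∃ S : SES X Y, Triangle.mk (t.ιHeart.map S.f) (t.ιHeart.map S.g) δ ∈ distTriang D := by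
  have hK := AbelianSubcategory.isLimitKernelForkOfDistTriang (hom_shift_eq_zero t A) f g δ hT
  have hC := AbelianSubcategory.isColimitCokernelCoforkOfDistTriang
    (hom_shift_eq_zero t A) f g δ hT
  have w : f ≫ g = 0 := t.ιHeart.map_injective (by
    rw [Functor.map_comp, Functor.map_zero]
    exact comp_distTriang_mor_zero₁₂ _ hT)
  refine ⟨⟨E, f, g, w, ?_⟩, hT⟩
  exact
    { exact := ShortComplex.exact_of_f_is_kernel _ hK
      mono_f := Fork.IsLimit.mono hK
      epi_g := Cofork.IsColimit.epi hC }

variable [IsTriangulated D]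

lemma SES.theta_surjective {X Y : A}
    (δ : ShiftedHom (t.ιHeart.obj X) (t.ιHeart.obj Y) (1 : ℤ)) :
    ∃ S : SES X Y, S.theta t = δ := by
  obtain ⟨E', f', g', hT⟩ := distinguished_cocone_triangle₂ δ
  obtain ⟨E, ⟨e⟩⟩ := exists_heart_iso t A E'
    (t.isLE₂ _ hT 0 (inferInstanceAs (t.IsLE (t.ιHeart.obj Y) 0))
      (inferInstanceAs (t.IsLE (t.ιHeart.obj X) 0)))
    (t.isGE₂ _ hT 0 (inferInstanceAs (t.IsGE (t.ιHeart.obj Y) 0))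
      (inferInstanceAs (t.IsGE (t.ιHeart.obj X) 0)))
  obtain ⟨f, hf⟩ := t.ιHeart.map_surjective (f' ≫ e.inv)
  obtain ⟨g, hg⟩ := t.ιHeart.map_surjective (e.hom ≫ g')
  obtain ⟨S, hS⟩ := exists_ses_of_distTriang t f g δ (by
    refine isomorphic_distinguished _ hT _
      (Triangle.isoMk _ _ (Iso.refl _) e (Iso.refl _) ?_ ?_ ?_)
    · change t.ιHeart.map f ≫ e.hom = 𝟙 _ ≫ f'
      simp [hf]
    · change t.ιHeart.map g ≫ 𝟙 _ = e.hom ≫ g'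
      simp [hg]
    · change δ ≫ (𝟙 _)⟦(1 : ℤ)⟧' = 𝟙 _ ≫ δ
      simp)
  exact ⟨S, S.theta_eq t δ hS⟩

lemma SES.hasMap_of_theta_eq {X Y : A} (S S' : SES X Y) (h : S.theta t = S'.theta t) :
    S.HasMap S' (𝟙 X) (𝟙 Y) := by
  obtain ⟨b, hb₁, hb₂⟩ := complete_distinguished_triangle_morphism₂ _ _
    (S.theta_distinguished t) (S'.theta_distinguished t) (𝟙 _) (𝟙 _) (by
      change S.theta t ≫ (𝟙 _)⟦(1 : ℤ)⟧' = 𝟙 _ ≫ S'.theta t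
      simp [h])
  obtain ⟨ε, rfl⟩ := t.ιHeart.map_surjective b
  refine ⟨ε, t.ιHeart.map_injective ?_, t.ιHeart.map_injective ?_⟩
  · rw [Functor.map_comp, id_comp]
    exact hb₁.trans (id_comp _)
  · rw [comp_id, Functor.map_comp]
    exact (comp_id _).symm.trans hb₂

lemma SES.theta_comp_map_f {X Y : A} (S : SES X Y) :
    S.theta t ≫ (t.ιHeart.map S.f)⟦(1 : ℤ)⟧' = 0 :=
  comp_distTriang_mor_zero₃₁ _ (S.theta_distinguished t)

/-- Every class in the image of `θⁿ` vanishes after composition with a suitable monomorphism. -/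
lemma NExtension.exists_mono_theta_comp_eq_zero {n : ℕ} {X Y : A} (ξ : NExtension n X Y) :
    ∃ (E : A) (j : Y ⟶ E) (_ : Mono j), ξ.theta t ≫ (t.ιHeart.map j)⟦(n : ℤ)⟧' = 0 := by
  cases ξ with
  | single S => exact ⟨_, S.f, inferInstance, S.theta_comp_map_f t⟩
  | splice S ξ =>
    refine ⟨_, S.f, inferInstance, ?_⟩
    have h := S.theta_comp_map_f t
    rw [← ShiftedHom.comp_mk₀ _ (0 : ℤ) rfl] at h ⊢
    simp only [NExtension.theta]
    rw [ShiftedHom.comp_assoc _ _ _ _ (zero_add _) (by push_cast; ring), h, ShiftedHom.comp_zero]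

lemma theta_splice {n : ℕ} {X Y Z : A} (S : SES Z Y) (x : Yext (n + 1) X Z) :
    theta t (n + 2) X Y (x.splice S) = ShiftedHom.comp (theta t (n + 1) X Z x) (S.theta t)
      (show (1 : ℤ) + ((n + 1 : ℕ) : ℤ) = ((n + 2 : ℕ) : ℤ) by push_cast; ring) := by
  obtain ⟨ξ, rfl⟩ := Quot.exists_rep x
  rfl

lemma theta_push {n : ℕ} {X Y Y' : A} (x : Yext n X Y) (β : Y ⟶ Y') :
    theta t n X Y' (x.push β) = theta t n X Y x ≫ (t.ιHeart.map β)⟦(n : ℤ)⟧' := by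
  obtain ⟨ξ, rfl⟩ := Quot.exists_rep x
  have h := NExtension.theta_naturality t (ξ.hasMap_push β)
  rw [CategoryTheory.Functor.map_id, id_comp] at h
  exact h.symm

lemma theta_one_bijective (X Y : A) : Function.Bijective (theta t 1 X Y) := by
  constructor
  · intro x y h
    obtain ⟨ξ, rfl⟩ := Quot.exists_rep x
    obtain ⟨η, rfl⟩ := Quot.exists_rep y
    cases ξ with
    | single S =>
      cases η with
      | single S' => exact Quot.sound (.single (S.hasMap_of_theta_eq t S' h))
  · intro δ
    obtain ⟨S, hS⟩ := SES.theta_surjective t δ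
    exact ⟨Quot.mk _ (.single S), hS⟩

/-- If `θⁿ⁺¹` is bijective for all pairs of objects of the heart, then `θⁿ⁺²` is injective. -/
lemma theta_injective_succ (n : ℕ)
    (h : ∀ X Y : A, Function.Bijective (theta t (n + 1) X Y)) (X Y : A) :
    Function.Injective (theta t (n + 2) X Y) := by
  have key : ∀ {Z : A} (S : SES Z Y) (a b : Yext (n + 1) X Z),
      theta t (n + 2) X Y (a.splice S) = theta t (n + 2) X Y (b.splice S) →
      a.splice S = b.splice S := by
    intro Z S a b hab
    rw [theta_splice, theta_splice] at hab
    obtain ⟨c, hc⟩ := shift_coyoneda_exact₂ (S.theta_distinguished t)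
      (show (1 : ℤ) + ((n + 1 : ℕ) : ℤ) = ((n + 2 : ℕ) : ℤ) by push_cast; ring)
      (theta t (n + 1) X Z a - theta t (n + 1) X Z b) (by
        rw [sub_eq_add_neg, ShiftedHom.add_comp, ShiftedHom.neg_comp, hab, add_neg_cancel])
    obtain ⟨x, rfl⟩ := (h X S.E).2 c
    obtain ⟨ξ, rfl⟩ := Quot.exists_rep x
    obtain ⟨E', j, _, hj⟩ := ξ.exists_mono_theta_comp_eq_zero t
    obtain ⟨Z', T, α, hT, e, he⟩ := S.exists_enlarge j
    have hj' : theta t (n + 1) X S.E (Quot.mk _ ξ) ≫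
      (t.ιHeart.map j)⟦((n + 1 : ℕ) : ℤ)⟧' = 0 := hj
    rw [Yext.splice_eq_of_hasMap hT a, Yext.splice_eq_of_hasMap hT b]
    congr 1
    apply (h X Z').1
    rw [theta_push, theta_push, ← sub_eq_zero, ← Preadditive.sub_comp, hc, assoc,
      ← Functor.map_comp, ← Functor.map_comp, he, Functor.map_comp, Functor.map_comp,
      reassoc_of% hj', zero_comp]
  intro x y hxy
  obtain ⟨Z, S, a, rfl⟩ := x.exists_eq_splice
  obtain ⟨Z', S', b, rfl⟩ := y.exists_eq_splice
  obtain ⟨Z'', T, α, α', hα, hα'⟩ := S.exists_common S'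
  rw [Yext.splice_eq_of_hasMap hα, Yext.splice_eq_of_hasMap hα'] at hxy ⊢
  exact key T _ _ hxy

/-- If the maps `θⁿ` are surjective, they are bijective. -/
lemma theta_bijective_of_surjective
    (h : ∀ n : ℕ, 1 ≤ n → ∀ X Y : A, Function.Surjective (theta t n X Y)) (n : ℕ) :
    ∀ X Y : A, Function.Bijective (theta t (n + 1) X Y) := by
  induction n with
  | zero => exact theta_one_bijective t
  | succ n hn => exact fun X Y => ⟨theta_injective_succ t n hn X Y, h _ (by lia) X Y⟩

/-- The maps `θⁿ` are surjective if all elements of degree at least `2` are effaceable. -/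
lemma theta_surjective_of_effaceable
    (h : ∀ (n : ℕ) (X Y : A) (f : ShiftedHom (t.ιHeart.obj X) (t.ιHeart.obj Y) ((n + 2 : ℕ) : ℤ)),
      ∃ (E : A) (j : Y ⟶ E) (_ : Mono j), f ≫ (t.ιHeart.map j)⟦((n + 2 : ℕ) : ℤ)⟧' = 0) (n : ℕ) :
    ∀ X Y : A, Function.Surjective (theta t (n + 1) X Y) := by
  induction n with
  | zero => exact fun X Y => (theta_one_bijective t X Y).2
  | succ n hn =>
    intro X Y f
    obtain ⟨E, j, _, hj⟩ := h n X Y f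
    obtain ⟨g, hg⟩ := shift_coyoneda_exact₁ ((SES.ofMono j).theta_distinguished t)
      (n := ((n + 1 : ℕ) : ℤ)) (by push_cast; ring) f hj
    obtain ⟨x, rfl⟩ := hn _ _ g
    exact ⟨x.splice (SES.ofMono j), (theta_splice t _ x).trans hg.symm⟩

lemma theta_add {n : ℕ} {X Y : A} (x y : Yext n X Y) :
    theta t n X Y (x + y) = theta t n X Y x + theta t n X Y y := by
  obtain ⟨ξ, rfl⟩ := Quot.exists_rep x
  obtain ⟨η, rfl⟩ := Quot.exists_rep y
  change (ξ.baerSum η).theta t = ξ.theta t + η.theta t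
  have h₁ := NExtension.theta_naturality t (((ξ.sum η).pull (biprod.lift (𝟙 X) (𝟙 X))).hasMap_push
    (biprod.desc (𝟙 Y) (𝟙 Y)))
  have h₂ := NExtension.theta_naturality t ((ξ.sum η).pull_hasMap (biprod.lift (𝟙 X) (𝟙 X)))
  have h₃ := NExtension.theta_naturality t (ξ.hasMap_sum_inl η)
  have h₄ := NExtension.theta_naturality t (ξ.hasMap_sum_inr η)
  simp only [CategoryTheory.Functor.map_id, id_comp, comp_id] at h₁ h₂
  have h₅ : biprod.lift (𝟙 X) (𝟙 X) = biprod.inl + biprod.inr := by ext <;> simp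
  rw [NExtension.baerSum, ← h₁, h₂, h₅, Functor.map_add, Preadditive.add_comp,
    Preadditive.add_comp, ← h₃, ← h₄, assoc, assoc, ← Functor.map_comp, ← Functor.map_comp,
    ← Functor.map_comp, ← Functor.map_comp, biprod.inl_desc, biprod.inr_desc,
    CategoryTheory.Functor.map_id, CategoryTheory.Functor.map_id, comp_id, comp_id]

end Theta

section Devissage

variable {C : Type*} [Category* C] [Preadditive C] [HasZeroObject C] [HasShift C ℤ]
  [∀ n : ℤ, (shiftFunctor C n).Additive] [Pretriangulated C]

/-- A bounded t-structure is generated by its heart. -/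
lemma prop_of_bounded [IsTriangulated C] (t : TStructure C) (P : ObjectProperty C)
    [P.IsTriangulated] [P.IsClosedUnderIsomorphisms] (h : t.heart ≤ P) : t.bounded ≤ P := by
  have key : ∀ (k : ℕ) (a : ℤ) (X : C), t.IsGE X a → t.IsLE X (a + k - 1) → P X := by
    intro k
    induction k with
    | zero =>
      intro a X _ _
      exact P.prop_of_isZero (t.isZero X (a + (0 : ℕ) - 1) a (by simp))
    | succ k hk =>
      intro a X _ hX
      have : t.IsLE X (a + k) := by
        convert hX using 1
        push_cast; ring
      have h₁ : P ((t.truncLE a).obj X) := by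
        have hLE : t.IsLE (((t.truncLE a).obj X)⟦a⟧) 0 := t.isLE_shift _ a a 0 (by lia)
        have hGE : t.IsGE (((t.truncLE a).obj X)⟦a⟧) 0 := t.isGE_shift _ a a 0 (by lia)
        have := P.le_shift (-a) _ (h _ ((t.mem_heart_iff _).2 ⟨hLE, hGE⟩))
        exact P.prop_of_iso ((shiftEquiv C a).unitIso.symm.app _) this
      have h₃ : P ((t.truncGE (a + 1)).obj X) :=
        hk (a + 1) _ inferInstance (by
          rw [show a + 1 + (k : ℤ) - 1 = a + k by ring]
          infer_instance)
      exact P.ext_of_isTriangulatedClosed₂ _ (t.triangleLEGE_distinguished a (a + 1) rfl X) h₁ h₃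
  rintro X ⟨⟨a, ha⟩, b, hb⟩
  refine key (b + 1 - a).toNat a X ha ?_
  exact t.isLE_of_le X b _ (by have := Int.self_le_toNat (b + 1 - a); lia)

variable {D : Type*} [Category* D] [Preadditive D] [HasZeroObject D] [HasShift D ℤ]
  [∀ n : ℤ, (shiftFunctor D n).Additive] [Pretriangulated D]

/-- The functor `F` is bijective on morphisms from `X` to `Y`. -/
def BijOn (F : C ⥤ D) (X Y : C) : Prop :=
  Function.Bijective (fun f : X ⟶ Y => F.map f)

namespace BijOn

variable {F : C ⥤ D}

omit [Preadditive C] [HasZeroObject C] [HasShift C ℤ] [∀ n : ℤ, (shiftFunctor C n).Additive]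
  [Pretriangulated C] [Preadditive D] [HasZeroObject D] [HasShift D ℤ]
  [∀ n : ℤ, (shiftFunctor D n).Additive] [Pretriangulated D] in
lemma of_iso {X Y X' Y' : C} (h : BijOn F X Y) (e : X ≅ X') (e' : Y ≅ Y') : BijOn F X' Y' := by
  constructor
  · intro f g hfg
    have : e.hom ≫ f ≫ e'.inv = e.hom ≫ g ≫ e'.inv := h.1 (by
      have hfg' : F.map f = F.map g := hfg
      simp [hfg'])
    simpa using this
  · intro g
    obtain ⟨f, hf⟩ := h.2 (F.map e.hom ≫ g ≫ F.map e'.inv)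
    have hf' : F.map f = F.map e.hom ≫ g ≫ F.map e'.inv := hf
    refine ⟨e.inv ≫ f ≫ e'.hom, ?_⟩
    change F.map (e.inv ≫ f ≫ e'.hom) = g
    simp [hf']

variable [F.CommShift ℤ]

omit [Preadditive C] [HasZeroObject C] [∀ n : ℤ, (shiftFunctor C n).Additive]
  [Pretriangulated C] [Preadditive D] [HasZeroObject D]
  [∀ n : ℤ, (shiftFunctor D n).Additive] [Pretriangulated D] in
lemma shift {X Y : C} (h : BijOn F X Y) (a : ℤ) : BijOn F (X⟦a⟧) (Y⟦a⟧) := by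
  have key : ∀ f : X ⟶ Y, F.map (f⟦a⟧') =
      (F.commShiftIso a).hom.app X ≫ (F.map f)⟦a⟧' ≫ (F.commShiftIso a).inv.app Y := by
    intro f
    have := (F.commShiftIso a).hom.naturality f
    dsimp at this
    rw [← reassoc_of% this, Iso.hom_inv_id_app]
    exact (comp_id _).symm
  constructor
  · intro f g hfg
    obtain ⟨f, rfl⟩ := (shiftFunctor C a).map_surjective f
    obtain ⟨g, rfl⟩ := (shiftFunctor C a).map_surjective g
    have hfg' : F.map (f⟦a⟧') = F.map (g⟦a⟧') := hfg
    rw [key, key, cancel_epi, cancel_mono] at hfg'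
    rw [h.1 ((shiftFunctor D a).map_injective hfg')]
  · intro g
    obtain ⟨g', hg'⟩ := (shiftFunctor D a).map_surjective
      ((F.commShiftIso a).inv.app X ≫ g ≫ (F.commShiftIso a).hom.app Y)
    obtain ⟨f, rfl⟩ := h.2 g'
    refine ⟨f⟦a⟧', ?_⟩
    change F.map (f⟦a⟧') = g
    have hg'' : (F.map f)⟦a⟧' =
      (F.commShiftIso a).inv.app X ≫ g ≫ (F.commShiftIso a).hom.app Y := hg'
    rw [key, hg'']
    simp

omit [Preadditive C] [HasZeroObject C] [∀ n : ℤ, (shiftFunctor C n).Additive]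
  [Pretriangulated C] [Preadditive D] [HasZeroObject D]
  [∀ n : ℤ, (shiftFunctor D n).Additive] [Pretriangulated D] in
lemma shift_left {X Y : C} (a b : ℤ) (hab : b + a = 0) (h : BijOn F X (Y⟦b⟧)) :
    BijOn F (X⟦a⟧) Y :=
  (h.shift a).of_iso (Iso.refl _) ((shiftFunctorCompIsoId C b a hab).app Y)

omit [Preadditive C] [HasZeroObject C] [∀ n : ℤ, (shiftFunctor C n).Additive]
  [Pretriangulated C] [Preadditive D] [HasZeroObject D]
  [∀ n : ℤ, (shiftFunctor D n).Additive] [Pretriangulated D] in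
lemma shift_right {X Y : C} (a b : ℤ) (hab : b + a = 0) (h : BijOn F (X⟦b⟧) Y) :
    BijOn F X (Y⟦a⟧) :=
  (h.shift a).of_iso ((shiftFunctorCompIsoId C b a hab).app X) (Iso.refl _)

variable [F.IsTriangulated]

variable (F) in
lemma exists_connecting {T : Triangle C} (hT : T ∈ distTriang C) :
    ∃ u : T.obj₃⟦(-1 : ℤ)⟧ ⟶ T.obj₁, u ≫ T.mor₁ = 0 ∧
      (∀ {Y : C} (a : T.obj₁ ⟶ Y), u ≫ a = 0 → ∃ b, a = T.mor₁ ≫ b) ∧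
      (∀ {Z : D} (g : Z ⟶ F.obj T.obj₁), g ≫ F.map T.mor₁ = 0 → ∃ k, g = k ≫ F.map u) :=
  ⟨T.invRotate.mor₁, comp_distTriang_mor_zero₁₂ _ (inv_rot_of_distTriang _ hT),
    fun a ha => Triangle.yoneda_exact₂ _ (inv_rot_of_distTriang _ hT) a ha,
    fun g hg => Triangle.coyoneda_exact₂ _
      (F.map_distinguished _ (inv_rot_of_distTriang _ hT)) g hg⟩

/-- A five lemma in the contravariant variable. -/
lemma of_distTriang₂ {T : Triangle C} (hT : T ∈ distTriang C) {Y : C}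
    (h₁ : BijOn F T.obj₁ Y) (h₁' : BijOn F (T.obj₁⟦(1 : ℤ)⟧) Y)
    (h₃ : BijOn F T.obj₃ Y) (h₃' : BijOn F (T.obj₃⟦(-1 : ℤ)⟧) Y) : BijOn F T.obj₂ Y := by
  have hFT := F.map_distinguished _ hT
  obtain ⟨u, hu, hu₁, hu₂⟩ := exists_connecting F hT
  constructor
  · suffices ∀ f : T.obj₂ ⟶ Y, F.map f = 0 → f = 0 by
      intro f g hfg
      exact sub_eq_zero.1 (this _ (by
        rw [F.map_sub]
        exact sub_eq_zero.2 hfg))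
    intro f hf
    obtain ⟨g, rfl⟩ := Triangle.yoneda_exact₂ _ hT f (h₁.1 (by simp [hf]))
    rw [F.map_comp] at hf
    obtain ⟨k, hk⟩ := Triangle.yoneda_exact₃ _ hFT (F.map g) hf
    obtain ⟨l, hl⟩ := h₁'.2 ((F.commShiftIso (1 : ℤ)).hom.app T.obj₁ ≫ k)
    have hl' : F.map l = (F.commShiftIso (1 : ℤ)).hom.app T.obj₁ ≫ k := hl
    have hg : g = T.mor₃ ≫ l := h₃.1 (by
      change F.map g = F.map (T.mor₃ ≫ l)
      rw [F.map_comp, hl', hk]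
      exact assoc _ _ _)
    rw [hg, comp_distTriang_mor_zero₂₃_assoc _ hT, zero_comp]
  · intro h
    obtain ⟨a, ha⟩ := h₁.2 (F.map T.mor₁ ≫ h)
    have ha' : F.map a = F.map T.mor₁ ≫ h := ha
    obtain ⟨b, rfl⟩ : ∃ b, a = T.mor₁ ≫ b :=
      hu₁ a (h₃'.1 (by
        change F.map (u ≫ a) = F.map 0
        rw [F.map_comp, ha', F.map_zero, ← F.map_comp_assoc, hu, F.map_zero, zero_comp]))
    obtain ⟨c, hc⟩ := Triangle.yoneda_exact₂ _ hFT (h - F.map b) (by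
      change F.map T.mor₁ ≫ (h - F.map b) = 0
      rw [Preadditive.comp_sub, ← ha', F.map_comp, sub_self])
    obtain ⟨d, rfl⟩ := h₃.2 c
    refine ⟨b + T.mor₂ ≫ d, ?_⟩
    change F.map (b + T.mor₂ ≫ d) = h
    have hc' : h - F.map b = F.map T.mor₂ ≫ F.map d := hc
    rw [F.map_add, F.map_comp, ← hc', add_sub_cancel]

/-- A five lemma in the covariant variable. -/
lemma of_distTriang₂' {T : Triangle C} (hT : T ∈ distTriang C) {X : C}
    (h₁ : BijOn F X T.obj₁) (h₁' : BijOn F X (T.obj₁⟦(1 : ℤ)⟧))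
    (h₃ : BijOn F X T.obj₃) (h₃' : BijOn F X (T.obj₃⟦(-1 : ℤ)⟧)) : BijOn F X T.obj₂ := by
  have hFT := F.map_distinguished _ hT
  obtain ⟨u, hu, hu₁, hu₂⟩ := exists_connecting F hT
  constructor
  · suffices ∀ f : X ⟶ T.obj₂, F.map f = 0 → f = 0 by
      intro f g hfg
      exact sub_eq_zero.1 (this _ (by
        rw [F.map_sub]
        exact sub_eq_zero.2 hfg))
    intro f hf
    obtain ⟨g, rfl⟩ := Triangle.coyoneda_exact₂ _ hT f (h₃.1 (by simp [hf]))
    rw [F.map_comp] at hf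
    obtain ⟨k, hk⟩ := hu₂ (F.map g) hf
    obtain ⟨l, rfl⟩ := h₃'.2 k
    have hg : g = l ≫ u := h₁.1 (by
      change F.map g = F.map (l ≫ u)
      rw [F.map_comp]
      exact hk)
    rw [hg, assoc, hu, comp_zero]
  · intro h
    obtain ⟨a, ha⟩ := h₃.2 (h ≫ F.map T.mor₂)
    have ha' : F.map a = h ≫ F.map T.mor₂ := ha
    obtain ⟨b, rfl⟩ : ∃ b, a = b ≫ T.mor₂ :=
      Triangle.coyoneda_exact₃ _ hT a (h₁'.1 (by
        change F.map (a ≫ T.mor₃) = F.map 0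
        rw [F.map_comp, ha', F.map_zero, assoc, ← F.map_comp, comp_distTriang_mor_zero₂₃ _ hT,
          F.map_zero, comp_zero]))
    obtain ⟨c, hc⟩ := Triangle.coyoneda_exact₂ _ hFT (h - F.map b) (by
      change (h - F.map b) ≫ F.map T.mor₂ = 0
      rw [Preadditive.sub_comp, ← ha', F.map_comp, sub_self])
    obtain ⟨d, rfl⟩ := h₁.2 c
    refine ⟨b + d ≫ T.mor₁, ?_⟩
    change F.map (b + d ≫ T.mor₁) = h
    have hc' : h - F.map b = F.map d ≫ F.map T.mor₁ := hc
    rw [F.map_add, F.map_comp, ← hc', add_sub_cancel]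

lemma of_isZero_left {X Y : C} (hX : IsZero X) : BijOn F X Y :=
  ⟨fun _ _ _ => hX.eq_of_src _ _, fun _ => ⟨0, (F.map_isZero hX).eq_of_src _ _⟩⟩

lemma of_isZero_right {X Y : C} (hY : IsZero Y) : BijOn F X Y :=
  ⟨fun _ _ _ => hY.eq_of_tgt _ _, fun _ => ⟨0, (F.map_isZero hY).eq_of_tgt _ _⟩⟩

variable (F) in
/-- The objects `X` such that `F` is bijective on morphisms from `X` to the shifts of `Y`. -/
def left (Y : C) : ObjectProperty C := fun X => ∀ n : ℤ, BijOn F X (Y⟦n⟧)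

variable (F) in
/-- The objects `Y` such that `F` is bijective on all morphisms to `Y`. -/
def right : ObjectProperty C := fun Y => ∀ X : C, BijOn F X Y

instance (Y : C) : (left F Y).IsClosedUnderIsomorphisms where
  of_iso e h n := (h n).of_iso e (Iso.refl _)

instance (Y : C) : (left F Y).IsStableUnderShift ℤ where
  isStableUnderShiftBy a :=
    { le_shift X hX n := .shift_left a (-a) (by simp)
        ((hX (n - a)).of_iso (Iso.refl _) ((shiftFunctorAdd' C n (-a) (n - a) (by ring)).app Y)) }

instance (Y : C) : (left F Y).IsTriangulated where
  exists_zero := ⟨_, isZero_zero C, fun _ => .of_isZero_left (isZero_zero C)⟩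
  toIsTriangulatedClosed₂ := .mk' fun _ hT h₁ h₃ n => .of_distTriang₂ hT (h₁ n)
    ((left F Y).le_shift (1 : ℤ) _ h₁ n) (h₃ n) ((left F Y).le_shift (-1 : ℤ) _ h₃ n)

instance : (right F).IsClosedUnderIsomorphisms where
  of_iso e h X := (h X).of_iso (Iso.refl _) e

instance : (right F).IsStableUnderShift ℤ where
  isStableUnderShiftBy a :=
    { le_shift Y hY X := .shift_right a (-a) (by simp) (hY _) }

instance : (right F).IsTriangulated where
  exists_zero := ⟨_, isZero_zero C, fun _ => .of_isZero_right (isZero_zero C)⟩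
  toIsTriangulatedClosed₂ := .mk' fun _ hT h₁ h₃ X => .of_distTriang₂' hT (h₁ X)
    ((right F).le_shift (1 : ℤ) _ h₁ X) (h₃ X) ((right F).le_shift (-1 : ℤ) _ h₃ X)

end BijOn

/-- A triangulated functor is bijective on morphisms between bounded objects if it is so on
morphisms between shifts of objects of the heart. -/
lemma bijOn_of_heart [IsTriangulated C] (t : TStructure C) (ht : ∀ X, t.bounded X)
    (F : C ⥤ D) [F.CommShift ℤ] [F.IsTriangulated]
    (h : ∀ X Y : C, t.heart X → t.heart Y → ∀ n : ℤ, BijOn F X (Y⟦n⟧)) (X Y : C) :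
    BijOn F X Y :=
  prop_of_bounded t (BijOn.right F) (fun Y hY X =>
    ((prop_of_bounded t (BijOn.left F Y) (fun X hX n => h X Y hX hY n) X (ht X)) 0).of_iso
      (Iso.refl _) ((shiftFunctorZero C ℤ).app Y)) Y (ht Y) X

/-- A full triangulated functor is essentially surjective if its essential image contains the
heart of a bounded t-structure. -/
lemma essSurj_of_heart [IsTriangulated D] (t : TStructure D) (ht : ∀ X, t.bounded X)
    (F : C ⥤ D) [F.CommShift ℤ] [F.IsTriangulated] [F.Full]
    (h : t.heart ≤ F.essImage) : F.EssSurj where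
  mem_essImage X := prop_of_bounded t F.essImage h X (ht X)

end Devissage

section DerivedCategory

variable {A : Type u} [Category.{v} A] [Abelian A] [HasDerivedCategory.{w} A]

/-- A morphism in the derived category from a stalk complex in degree `0` to a stalk complex in
negative degree is killed by a monomorphism. -/
lemma exists_mono_comp_singleFunctor_map_eq_zero {X Y : A} {m : ℤ} (hm : m < 0)
    (f : (DerivedCategory.singleFunctor A 0).obj X ⟶ (DerivedCategory.singleFunctor A m).obj Y) :
    ∃ (E : A) (j : Y ⟶ E) (_ : Mono j), f ≫ (DerivedCategory.singleFunctor A m).map j = 0 := by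
  obtain ⟨K, _, g, s, _, hf⟩ := DerivedCategory.left_fac_of_isStrictlyGE
    (X := (HomologicalComplex.single A (ComplexShape.up ℤ) 0).obj X)
    (Y := (HomologicalComplex.single A (ComplexShape.up ℤ) m).obj Y) f m
  let p : K ⟶ (HomologicalComplex.single A (ComplexShape.up ℤ) m).obj (K.X m) :=
    HomologicalComplex.mkHomToSingle (𝟙 _) (fun i hi => by
      have : i + 1 = m := hi
      exact (K.isZero_of_isStrictlyGE m i (by lia)).eq_of_src _ _)
  let j : Y ⟶ K.X m := (HomologicalComplex.singleObjXSelf (ComplexShape.up ℤ) m Y).inv ≫ s.f m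
  have hj : s ≫ p = (HomologicalComplex.single A (ComplexShape.up ℤ) m).map j := by
    apply HomologicalComplex.to_single_hom_ext
    simp [p, j, HomologicalComplex.single_map_f_self]
  have hg : g ≫ p = 0 := by
    apply HomologicalComplex.to_single_hom_ext
    exact (HomologicalComplex.isZero_single_obj_X (ComplexShape.up ℤ) 0 X m (by lia)).eq_of_src _ _
  refine ⟨K.X m, j, ?_, ?_⟩
  · refine Preadditive.mono_of_cancel_zero _ fun {T} k hk => ?_
    have h₁ : (HomologicalComplex.single A (ComplexShape.up ℤ) m).map k ≫ s = 0 := by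
      apply HomologicalComplex.from_single_hom_ext
      simp only [j] at hk
      simp [HomologicalComplex.single_map_f_self, hk]
    have h₂ := DerivedCategory.Q.congr_map h₁
    rw [Functor.map_comp, Functor.map_zero] at h₂
    apply (DerivedCategory.singleFunctor A m).map_injective
    rw [Functor.map_zero]
    have h₃ : DerivedCategory.Q.map ((HomologicalComplex.single A (ComplexShape.up ℤ) m).map k) =
        0 := by
      rw [← cancel_mono (DerivedCategory.Q.map s), h₂, zero_comp]
    exact h₃
  · have h : (DerivedCategory.Q.map g ≫ inv (DerivedCategory.Q.map s)) ≫
        DerivedCategory.Q.map ((HomologicalComplex.single A (ComplexShape.up ℤ) m).map j) = 0 := by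
      rw [← hj, Functor.map_comp, assoc, IsIso.inv_hom_id_assoc, ← Functor.map_comp, hg,
        Functor.map_zero]
    subst hf
    exact h

/-- The elements of positive degree of the `Ext`-groups are effaceable. -/
lemma exists_mono_comp_stalk_map_eq_zero {X Y : A} {m : ℤ} (hm : 0 < m)
    (f : (stalk A).obj X ⟶ ((stalk A).obj Y)⟦m⟧) :
    ∃ (E : A) (j : Y ⟶ E) (_ : Mono j), f ≫ ((stalk A).map j)⟦m⟧' = 0 := by
  let e := (DerivedCategory.singleFunctors A).shiftIso m (-m) 0 (by simp)
  let c := (DerivedCategory.Bounded.ι (C := A)).commShiftIso m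
  obtain ⟨E, j, hj, h⟩ := exists_mono_comp_singleFunctor_map_eq_zero (m := -m) (by lia)
    ((DerivedCategory.Bounded.ι (C := A)).map f ≫ c.hom.app ((stalk A).obj Y) ≫ e.hom.app Y)
  refine ⟨E, j, hj, (DerivedCategory.Bounded.ι (C := A)).map_injective ?_⟩
  rw [Functor.map_comp, Functor.map_zero, ← cancel_mono (c.hom.app ((stalk A).obj E)),
    ← cancel_mono (e.hom.app E), zero_comp, zero_comp, ← h]
  have h₁ := c.hom.naturality ((stalk A).map j)
  have h₂ := e.hom.naturality j
  simp only [Functor.comp_map, assoc] at h₁ h₂ ⊢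
  rw [reassoc_of% h₁]
  exact congrArg (fun q => (DerivedCategory.Bounded.ι (C := A)).map f ≫
    c.hom.app ((stalk A).obj Y) ≫ q) h₂

/-- The canonical maps `χⁿ` are surjective. -/
lemma chi_surjective (n : ℕ) (hn : 1 ≤ n) (X Y : A) : Function.Surjective (chi.{w} n X Y) := by
  obtain ⟨n, rfl⟩ : ∃ k, n = k + 1 := ⟨n - 1, by lia⟩
  exact theta_surjective_of_effaceable (tCan A) (fun n X Y f =>
    exists_mono_comp_stalk_map_eq_zero (m := ((n + 2 : ℕ) : ℤ)) (by lia) f) n X Y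

end DerivedCategory

namespace RealizationFunctor

variable {D : Type u} [Category.{v} D] [Preadditive D] [HasZeroObject D] [HasShift D ℤ]
  [∀ n : ℤ, (shiftFunctor D n).Additive] [Pretriangulated D] [IsTriangulated D]
  {t : TStructure D} [HasDerivedCategory.{w} t.heart.FullSubcategory]
  (F : RealizationFunctor.{w} t)

/-- The map induced by a realization functor on shifted morphisms of integral degree. -/
noncomputable def shiftedMap {X Y : t.heart.FullSubcategory} {n : ℤ}
    (f : ShiftedHom ((tCan t.heart.FullSubcategory).ιHeart.obj X)
      ((tCan t.heart.FullSubcategory).ιHeart.obj Y) n) :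
    ShiftedHom (t.ιHeart.obj X) (t.ιHeart.obj Y) n :=
  F.iso.inv.app X ≫ ShiftedHom.map f F.F ≫ (F.iso.hom.app Y)⟦n⟧'

lemma shiftedMap_comp {X Y Z : t.heart.FullSubcategory} {a b c : ℤ}
    (f : ShiftedHom ((tCan t.heart.FullSubcategory).ιHeart.obj X)
      ((tCan t.heart.FullSubcategory).ιHeart.obj Y) a)
    (g : ShiftedHom ((tCan t.heart.FullSubcategory).ιHeart.obj Y)
      ((tCan t.heart.FullSubcategory).ιHeart.obj Z) b) (h : b + a = c) :
    F.shiftedMap (f.comp g h) = (F.shiftedMap f).comp (F.shiftedMap g) h := by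
  have hn := (shiftFunctorAdd' D b a c h).inv.naturality (F.iso.hom.app Z)
  have hi : (F.iso.hom.app Y)⟦a⟧' ≫ (F.iso.inv.app Y)⟦a⟧' = 𝟙 _ := by
    rw [← Functor.map_comp, Iso.hom_inv_id_app, CategoryTheory.Functor.map_id]
  rw [Functor.comp_map] at hn
  rw [shiftedMap, ShiftedHom.map_comp, shiftedMap, shiftedMap, ShiftedHom.comp, ShiftedHom.comp]
  simp only [Functor.map_comp, assoc]
  rw [reassoc_of% hi]
  congr 3
  exact hn.symm

lemma shiftedMap_theta_ses {X Y : t.heart.FullSubcategory} (S : SES X Y) :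
    F.shiftedMap (S.theta (tCan t.heart.FullSubcategory)) = S.theta t := by
  refine (S.theta_eq t _ ?_).symm
  refine isomorphic_distinguished _ (F.F.map_distinguished _
    (S.theta_distinguished (tCan t.heart.FullSubcategory))) _ ?_
  refine Triangle.isoMk _ _ (F.iso.symm.app Y) (F.iso.symm.app S.E) (F.iso.symm.app X) ?_ ?_ ?_
  · exact F.iso.inv.naturality S.f
  · exact F.iso.inv.naturality S.g
  · change F.shiftedMap (S.theta (tCan t.heart.FullSubcategory)) ≫ (F.iso.inv.app Y)⟦(1 : ℤ)⟧' =
      F.iso.inv.app X ≫ ShiftedHom.map (S.theta (tCan t.heart.FullSubcategory)) F.F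
    have hi : (F.iso.hom.app Y)⟦(1 : ℤ)⟧' ≫ (F.iso.inv.app Y)⟦(1 : ℤ)⟧' = 𝟙 _ := by
      rw [← Functor.map_comp, Iso.hom_inv_id_app, CategoryTheory.Functor.map_id]
    rw [shiftedMap, assoc, assoc, hi]
    exact congrArg _ (comp_id _)

lemma shiftedMap_theta {n : ℕ} {X Y : t.heart.FullSubcategory} (ξ : NExtension n X Y) :
    F.shiftedMap (ξ.theta (tCan t.heart.FullSubcategory)) = ξ.theta t := by
  induction ξ with
  | single S => exact F.shiftedMap_theta_ses S
  | splice S ξ h =>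
    simp only [NExtension.theta]
    rw [shiftedMap_comp, h, shiftedMap_theta_ses]

lemma extMap_chi {n : ℕ} {X Y : t.heart.FullSubcategory} (x : Yext n X Y) :
    F.extMap n X Y (chi n X Y x) = theta t n X Y x := by
  obtain ⟨ξ, rfl⟩ := Quot.exists_rep x
  exact F.shiftedMap_theta ξ

lemma extMap_bijective_of_theta {n : ℕ} (hn : 1 ≤ n) {X Y : t.heart.FullSubcategory}
    (h : Function.Bijective (theta t n X Y)) : Function.Bijective (F.extMap n X Y) := by
  have hc : F.extMap n X Y ∘ chi n X Y = theta t n X Y := funext F.extMap_chi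
  have hs := chi_surjective.{w} n hn X Y
  refine ⟨fun a b hab => ?_, .of_comp (g := chi n X Y) (hc ▸ h.2)⟩
  obtain ⟨x, rfl⟩ := hs a
  obtain ⟨y, rfl⟩ := hs b
  rw [extMap_chi, extMap_chi] at hab
  rw [h.1 hab]

lemma extMap_two_injective (X Y : t.heart.FullSubcategory) :
    Function.Injective (F.extMap 2 X Y) := by
  intro a b hab
  obtain ⟨x, rfl⟩ := chi_surjective.{w} 2 (by lia) X Y a
  obtain ⟨y, rfl⟩ := chi_surjective.{w} 2 (by lia) X Y b
  rw [extMap_chi, extMap_chi] at hab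
  rw [theta_injective_succ t 0 (theta_one_bijective t) X Y hab]

lemma shiftedMap_bijective_iff {X Y : t.heart.FullSubcategory} {n : ℤ} :
    Function.Bijective (F.shiftedMap (X := X) (Y := Y) (n := n)) ↔
      BijOn F.F ((tCan t.heart.FullSubcategory).ιHeart.obj X)
        (((tCan t.heart.FullSubcategory).ιHeart.obj Y)⟦n⟧) := by
  let e : (F.F.obj ((tCan t.heart.FullSubcategory).ιHeart.obj X) ⟶
      F.F.obj (((tCan t.heart.FullSubcategory).ιHeart.obj Y)⟦n⟧)) ≃
      (t.ιHeart.obj X ⟶ (t.ιHeart.obj Y)⟦n⟧) :=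
    Iso.homCongr (F.iso.app X) ((F.F.commShiftIso n).app _ ≪≫
      (shiftFunctor D n).mapIso (F.iso.app Y))
  have : (F.shiftedMap (X := X) (Y := Y) (n := n)) = e ∘ fun f => F.F.map f := by
    ext f
    simp [e, shiftedMap, ShiftedHom.map]
  rw [this]
  exact e.bijective.of_comp_iff' _

lemma bijOn_heart
    (h : ∀ n : ℕ, 1 ≤ n → ∀ X Y : t.heart.FullSubcategory, Function.Bijective (F.extMap n X Y))
    (X Y : t.heart.FullSubcategory) (n : ℤ) :
    BijOn F.F ((tCan t.heart.FullSubcategory).ιHeart.obj X)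
        (((tCan t.heart.FullSubcategory).ιHeart.obj Y)⟦n⟧) := by
  obtain hn | rfl | hn := lt_trichotomy n 0
  · rw [← shiftedMap_bijective_iff]
    constructor
    · intro f g _
      rw [hom_shift_eq_zero _ _ f hn, hom_shift_eq_zero _ _ g hn]
    · intro g
      exact ⟨0, (hom_shift_eq_zero _ _ _ hn).trans (hom_shift_eq_zero _ _ g hn).symm⟩
  · have h₀ : BijOn F.F ((tCan t.heart.FullSubcategory).ιHeart.obj X)
        ((tCan t.heart.FullSubcategory).ιHeart.obj Y) := by
      have key : ∀ f : X ⟶ Y, F.F.map ((tCan t.heart.FullSubcategory).ιHeart.map f) =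
          F.iso.hom.app X ≫ t.ιHeart.map f ≫ F.iso.inv.app Y := by
        intro f
        rw [← assoc, ← F.iso.hom.naturality, assoc, Iso.hom_inv_id_app]
        exact (comp_id _).symm
      constructor
      · intro f g hfg
        obtain ⟨f, rfl⟩ := (tCan t.heart.FullSubcategory).ιHeart.map_surjective f
        obtain ⟨g, rfl⟩ := (tCan t.heart.FullSubcategory).ιHeart.map_surjective g
        have hfg' : F.F.map ((tCan t.heart.FullSubcategory).ιHeart.map f) =
          F.F.map ((tCan t.heart.FullSubcategory).ιHeart.map g) := hfg
        rw [key, key, cancel_epi, cancel_mono] at hfg'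
        rw [t.ιHeart.map_injective hfg']
      · intro g
        obtain ⟨f, hf⟩ := t.ιHeart.map_surjective (F.iso.inv.app X ≫ g ≫ F.iso.hom.app Y)
        refine ⟨(tCan t.heart.FullSubcategory).ιHeart.map f, ?_⟩
        change F.F.map ((tCan t.heart.FullSubcategory).ιHeart.map f) = g
        rw [key, hf]
        simp
    exact h₀.of_iso (Iso.refl _) ((shiftFunctorZero _ ℤ).symm.app _)
  · obtain ⟨m, rfl⟩ := Int.eq_ofNat_of_zero_le hn.le
    rw [← shiftedMap_bijective_iff]
    exact h m (by lia) X Y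

lemma tCan_bounded {A : Type u} [Category.{v} A] [Abelian A] [HasDerivedCategory.{w} A]
    (X : DerivedCategory.Bounded A) : (tCan A).bounded X := by
  obtain ⟨⟨a, ha⟩, b, hb⟩ := X.property
  exact ⟨⟨a, ⟨ha.1⟩⟩, b, ⟨hb.1⟩⟩

lemma isEquivalence_of_extMap_bijective (ht : ∀ X : D, t.bounded X)
    (h : ∀ n : ℕ, 1 ≤ n → ∀ X Y : t.heart.FullSubcategory, Function.Bijective (F.extMap n X Y)) :
    F.F.IsEquivalence := by
  have hb : ∀ X Y, BijOn F.F X Y := bijOn_of_heart (tCan t.heart.FullSubcategory)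
    tCan_bounded F.F (fun X Y hX hY n => by
      rw [← (tCan t.heart.FullSubcategory).essImage_ιHeart t.heart.FullSubcategory] at hX hY
      obtain ⟨X', ⟨e⟩⟩ := hX
      obtain ⟨Y', ⟨e'⟩⟩ := hY
      exact (F.bijOn_heart h X' Y' n).of_iso e ((shiftFunctor _ n).mapIso e'))
  have : F.F.Full := ⟨fun {X Y} g => (hb X Y).2 g⟩
  have : F.F.Faithful := ⟨fun {X Y} f g hfg => (hb X Y).1 hfg⟩
  have : F.F.EssSurj := essSurj_of_heart t ht F.F fun X hX =>
    ⟨_, ⟨F.iso.app (⟨X, hX⟩ : t.heart.FullSubcategory)⟩⟩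
  exact { }

lemma extMap_surjective [F.F.Full] (n : ℕ) (X Y : t.heart.FullSubcategory) :
    Function.Surjective (F.extMap n X Y) := by
  intro g
  obtain ⟨f, hf⟩ := F.F.map_surjective (F.iso.hom.app X ≫ g ≫ (F.iso.inv.app Y)⟦(n : ℤ)⟧' ≫
    (F.F.commShiftIso (n : ℤ)).inv.app _)
  refine ⟨f, ?_⟩
  change F.iso.inv.app X ≫ (F.F.map f ≫ (F.F.commShiftIso (n : ℤ)).hom.app _) ≫
    (F.iso.hom.app Y)⟦(n : ℤ)⟧' = g
  rw [hf]
  simp [← Functor.map_comp]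

end RealizationFunctor

end CanonicalMaps

theorem corollary2p8 {D : Type u} [Category.{v} D] [Preadditive D] [HasZeroObject D]
    [HasShift D ℤ] [∀ n : ℤ, (shiftFunctor D n).Additive] [Pretriangulated D] [IsTriangulated D]
    (t : TStructure D) (ht : ∀ X : D, t.bounded X)
    [HasDerivedCategory.{w} t.heart.FullSubcategory]
    (F : CanonicalMaps.RealizationFunctor.{w} t) :
    (∀ (n : ℕ), 1 ≤ n → ∀ (X Y : t.heart.FullSubcategory) (ξ : CanonicalMaps.Yext n X Y),
      F.extMap n X Y (CanonicalMaps.chi n X Y ξ) = CanonicalMaps.theta t n X Y ξ) ∧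
    (∀ X Y : t.heart.FullSubcategory, Function.Bijective (F.extMap 1 X Y)) ∧
    (∀ X Y : t.heart.FullSubcategory, Function.Injective (F.extMap 2 X Y)) ∧
    List.TFAE [
      F.F.Full,
      F.F.IsEquivalence,
      ∀ (n : ℕ), 1 ≤ n → ∀ X Y : t.heart.FullSubcategory,
        ∃ e : CanonicalMaps.Yext n X Y ≃+ ShiftedHom (t.ιHeart.obj X) (t.ιHeart.obj Y) (n : ℤ),
          ⇑e = CanonicalMaps.theta t n X Y,
      ∀ (n : ℕ), 1 ≤ n → ∀ X Y : t.heart.FullSubcategory,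
        Function.Surjective (CanonicalMaps.theta t n X Y)] := by
  refine ⟨fun n _ X Y ξ => F.extMap_chi ξ,
    fun X Y => F.extMap_bijective_of_theta le_rfl (CanonicalMaps.theta_one_bijective t X Y),
    F.extMap_two_injective, ?_⟩
  tfae_have 1 → 4 := by
    intro _ n hn X Y
    rw [← (funext F.extMap_chi : F.extMap n X Y ∘ CanonicalMaps.chi n X Y = _)]
    exact (F.extMap_surjective n X Y).comp (CanonicalMaps.chi_surjective n hn X Y)
  tfae_have 4 → 3 := by
    intro h n hn X Y
    obtain ⟨n, rfl⟩ : ∃ k, n = k + 1 := ⟨n - 1, by lia⟩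
    exact ⟨{ Equiv.ofBijective _ (CanonicalMaps.theta_bijective_of_surjective t h n X Y) with
      map_add' := CanonicalMaps.theta_add t }, rfl⟩
  tfae_have 3 → 2 := by
    intro h
    refine F.isEquivalence_of_extMap_bijective ht fun n hn X Y =>
      F.extMap_bijective_of_theta hn ?_
    obtain ⟨e, he⟩ := h n hn X Y
    rw [← he]
    exact e.bijective
  tfae_have 2 → 1 := fun _ => inferInstance
  tfae_finish
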